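/- Words are elements of the free monoid $\mathfrak A^*$ over a countably infinite alphabet $\mathfrak A$ containing pairwise distinct letters $a,b,t_1,t_2,\dots$; $\operatorname{var}\Sigma$ denotes the variety of all monoids satisfying the set of identities $\Sigma$. Put $\mathbf u_0=a^2b^2$, $\mathbf v_0=b^2a^2$, and, for $k\ge 0$, \[\mathbf u_{k+1}=c_k\,t_{k+1}\mathbf u_k,\qquad \mathbf v_{k+1}=c_k\,t_{k+1}\mathbf v_k,\qquad c_k=a \text{ if } k \text{ is even},\quad c_k=b \text{ if } k \text{ is odd}.\] Let $\mathbb E^1=\operatorname{var}\{xtx\approx xtx^2\approx x^2tx,\ xy^2x\approx x^2y^2\}$ and, for $n\ge1$, $\mathbb E^1\{\sigma_n\}=\operatorname{var}\{xtx\approx xtx^2\approx x^2tx,\ xy^2x\approx x^2y^2,\ \mathbf u_n\approx\mathbf v_n\}$. Let $\beta$ be the fully invariant congruence of $\mathbb E^1$ on $\mathfrak A^*$, that is, $\mathbf u\mathrel\beta\mathbf v$ iff $\mathbb E^1$ satisfies $\mathbf u\approx\mathbf v$, and let $[\mathbf w]_\beta$ be the $\beta$-class of $\mathbf w$. For a union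 $W\subseteq\mathfrak A^*$ of $\beta$-classes let $I_W\subseteq\mathfrak A^*/\beta$ be the ideal of all classes $\mathtt c$ such that no class of a word of $W$ has the form $\mathtt p\,\mathtt c\,\mathtt s$ with $\mathtt p,\mathtt s\in\mathfrak A^*/\beta$; let $M_\beta(W)$ be the Rees quotient of $\mathfrak A^*/\beta$ over $I_W$ (and $\mathfrak A^*/\beta$ itself if $I_W=\varnothing$), and let $\mathbb M_\beta(W)$ be the monoid variety generated by $M_\beta(W)$. A set $W$ of words is stable with respect to a monoid variety $\mathbb V$ if $\mathbf v\in W$ whenever $\mathbf u\in W$ and $\mathbb V$ satisfies $\mathbf u\approx\mathbf v$. Then for each $n\ge1$: (i) $\mathbb E^1\{\sigma_{n+1}\}=\mathbb M_\beta([\mathbf v_n]_\beta)$; in particular, $\mathbb E^1\{\sigma_2\}=\mathbb M_\beta([at_1b^2a]_\beta)$; (ii) a monoid variety $\mathbb V$ contains $\mathbb E^1\{\sigma_{n+1}\}$ if and only if the $\beta$-class $[\mathbf v_n]_\beta$ is stable with respect to $\mathbb V$. -/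

import Mathlib

universe u

namespace MonVar

/-- Words over the countably infinite alphabet `ℕ`. -/
abbrev Word : Type := FreeMonoid ℕ

/-- The monoid `M` satisfies the identity `p ≈ q`: every substitution of elements of `M` for the
letters makes the two sides equal. -/
def Satisfies (M : Type u) [Monoid M] (p q : Word) : Prop :=
  ∀ f : ℕ → M, FreeMonoid.lift f p = FreeMonoid.lift f q

/-- A monoid variety: a class of monoids that is the class of all models of some set of
identities. -/
@[ext]
structure MonoidVariety where
  /-- the monoids that belong to the variety -/
  Mem : (M : Type u) → [Monoid M] → Prop
  /-- the class is defined by a set of identities -/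
  equational : ∃ S : Set (Word × Word), ∀ (M : Type u) [Monoid M],
    Mem M ↔ ∀ p ∈ S, Satisfies M p.1 p.2

namespace MonoidVariety

/-- `V ≤ V'`: the variety `V` is contained in the variety `V'`. -/
instance : LE MonoidVariety.{u} where
  le V V' := ∀ (M : Type u) [Monoid M], V.Mem M → V'.Mem M

/-- `var S`: the variety defined by the set of identities `S`. -/
def var (S : Set (Word × Word)) : MonoidVariety.{u} where
  Mem M _ := ∀ p ∈ S, Satisfies M p.1 p.2
  equational := ⟨S, fun _ _ => Iff.rfl⟩

/-- The variety generated by the monoid `M`: the intersection of all varieties containing `M`. -/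
def generatedBy (M : Type u) [Monoid M] : MonoidVariety.{u} where
  Mem N _ := ∀ V : MonoidVariety.{u}, V.Mem M → V.Mem N
  equational := by
    refine ⟨{p | Satisfies M p.1 p.2}, fun N _ => ⟨fun h => ?_, fun h V hV => ?_⟩⟩
    · exact h (var {p | Satisfies M p.1 p.2}) (fun p hp => hp)
    · obtain ⟨S, hS⟩ := V.equational
      exact (hS N).2 fun p hp => h p ((hS M).1 hV p hp)

/-- The variety `V` satisfies the identity `p ≈ q`. -/
def Models (V : MonoidVariety.{u}) (p q : Word) : Prop :=
  ∀ (M : Type u) [Monoid M], V.Mem M → Satisfies M p q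

/-- The fully invariant congruence of `V` on the free monoid of words. -/
def congruence (V : MonoidVariety.{u}) : Con Word where
  r p q := V.Models p q
  iseqv :=
    { refl := fun _ _ _ _ _ => rfl
      symm := fun h M _ hM f => (h M hM f).symm
      trans := fun h h' M _ hM f => (h M hM f).trans (h' M hM f) }
  mul' := fun h h' M _ hM f => by
    rw [map_mul, map_mul, h M hM f, h' M hM f]

/-- The set of words `W` is stable with respect to `V`. -/
def Stable (V : MonoidVariety.{u}) (W : Set Word) : Prop :=
  ∀ p ∈ W, ∀ q : Word, V.Models p q → q ∈ W

end MonoidVariety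

/-- The Rees congruence of a two-sided ideal `I` (possibly empty) of a monoid `Q`: the elements
of `I` are identified with each other, and no others. -/
def reesCon {Q : Type u} [Monoid Q] (I : Set Q)
    (hl : ∀ q : Q, ∀ i ∈ I, q * i ∈ I) (hr : ∀ i ∈ I, ∀ q : Q, i * q ∈ I) : Con Q where
  r x y := x = y ∨ (x ∈ I ∧ y ∈ I)
  iseqv :=
    { refl := fun _ => Or.inl rfl
      symm := fun h => h.elim (fun e => Or.inl e.symm) (fun e => Or.inr ⟨e.2, e.1⟩)
      trans := by
        rintro x y z (rfl | ⟨hx, hy⟩) (rfl | ⟨hy', hz⟩)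
        · exact Or.inl rfl
        · exact Or.inr ⟨hy', hz⟩
        · exact Or.inr ⟨hx, hy⟩
        · exact Or.inr ⟨hx, hz⟩ }
  mul' := by
    rintro w x y z (rfl | ⟨hw, hx⟩) (rfl | ⟨hy, hz⟩)
    · exact Or.inl rfl
    · exact Or.inr ⟨hl _ _ hy, hl _ _ hz⟩
    · exact Or.inr ⟨hr _ hw _, hr _ hx _⟩
    · exact Or.inr ⟨hr _ hw _, hr _ hx _⟩

/-- The `τ`-classes that are not below (in the extended subword quasi-order: `c ≤ d` iff
`d = p * c * s` for some classes `p`, `s`) the class of any word of `W`. -/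
def outside (τ : Con Word) (W : Set Word) : Set τ.Quotient :=
  {c | ¬ ∃ w ∈ W, ∃ p s : τ.Quotient, (w : τ.Quotient) = p * c * s}

/-- The congruence on the quotient by `τ` collapsing the classes outside the closure of `W`. -/
def MWCon (τ : Con Word) (W : Set Word) : Con τ.Quotient :=
  reesCon (outside τ W)
    (fun q i hi ⟨w, hw, p, s, h⟩ => hi ⟨w, hw, p * q, s, by rw [h]; simp only [mul_assoc]⟩)
    (fun i hi q ⟨w, hw, p, s, h⟩ => hi ⟨w, hw, p, q * s, by rw [h]; simp only [mul_assoc]⟩)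

/-- The monoid `M_τ(W)`, for `W` a union of `τ`-classes: the Rees quotient of the quotient of the
free monoid by `τ` over the ideal of classes outside the closure of `W`. If that ideal is empty,
nothing is collapsed and this is the quotient by `τ` itself. -/
abbrev MW (τ : Con Word) (W : Set Word) : Type := (MWCon τ W).Quotient

/-- The variety generated by `M_τ(W)`, as a class of monoids in an arbitrary universe. -/
def varMW (τ : Con Word) (W : Set Word) : MonoidVariety.{u} :=
  MonoidVariety.generatedBy (ULift.{u} (MW τ W))

/-- the letter `a` -/
def a : Word := FreeMonoid.of 0

/-- the letter `b` -/
def b : Word := FreeMonoid.of 1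

/-- the letters `t₁, t₂, …`, different from `a` and `b` -/
def t (k : ℕ) : Word := FreeMonoid.of (k + 2)

/-- `u₀ = a²b²`; `uₖ₊₁ = a tₖ₊₁ uₖ` for even `k` and `uₖ₊₁ = b tₖ₊₁ uₖ` for odd `k`. -/
def uWord : ℕ → Word
  | 0 => a ^ 2 * b ^ 2
  | k + 1 => (if Even k then a else b) * t (k + 1) * uWord k

/-- `v₀ = b²a²`; `vₖ₊₁ = a tₖ₊₁ vₖ` for even `k` and `vₖ₊₁ = b tₖ₊₁ vₖ` for odd `k`. -/
def vWord : ℕ → Word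
  | 0 => b ^ 2 * a ^ 2
  | k + 1 => (if Even k then a else b) * t (k + 1) * vWord k

/-- The identities `xtx ≈ xtx²`, `xtx² ≈ x²tx`, `xy²x ≈ x²y²`, written with the letters
`x = a`, `y = b`, `t = t₁`. -/
def E1Identities : Set (Word × Word) :=
  {(a * t 1 * a, a * t 1 * a ^ 2), (a * t 1 * a ^ 2, a ^ 2 * t 1 * a),
    (a * b ^ 2 * a, a ^ 2 * b ^ 2)}

/-- The variety `𝔼¹ = var {xtx ≈ xtx² ≈ x²tx, xy²x ≈ x²y²}`. -/
def E1 : MonoidVariety.{u} := MonoidVariety.var E1Identities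

/-- The variety `𝔼¹{σₙ} = var {xtx ≈ xtx² ≈ x²tx, xy²x ≈ x²y², uₙ ≈ vₙ}`. -/
def E1sigma (n : ℕ) : MonoidVariety.{u} :=
  MonoidVariety.var (E1Identities ∪ {(uWord n, vWord n)})

/-- `β`: the fully invariant congruence of `𝔼¹`. -/
def beta : Con Word := MonoidVariety.congruence E1.{0}

/-- The `β`-class of a word. -/
def betaClass (w : Word) : Set Word := {w' | beta w w'}

end MonVar

/-! For n ≥ 1 the β-class of `vWord n` is a regular language: the words c⁺ tₙ ⋯ b⁺ t₂ a⁺ t₁ b⁺ a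
{a,b}* with at least two occurrences of b (`mem_betaClass_iff`). Call a letter multiple if it occurs
at least twice and simple if it occurs once; blocks are the factors between consecutive simple
letters. In 𝔼¹ a multiple letter already met in its block may be erased (`IsE1.ev_absorb`), so only
the order of first occurrences in each block counts, and this rewrites every word of the language to
`vWord n`. Conversely the syntactic monoid of the language lies in 𝔼¹ (`isE1_synCon`).

Everything is then reduced to `Rho n U V`: the identity U ≈ V holds in that syntactic monoid. The
syntactic monoid and the Rees quotient both satisfy uₙ₊₁ ≈ vₙ₊₁, since an instance whose sides are
not already β-equal would have to descend through n + 1 levels of the automaton, while `vWord n`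
offers n (`IsE1.ev_sigma`).

The core is the converse `Rho.ev_eq`: `Rho n U V` forces U ≈ V in 𝔼¹{σₙ₊₁}. Substitutions into
`vWord n` show that U and V agree in their simple letters, in the order of these, and in which
letters each block contains. U is then rewritten greedily, letter by letter, to share ever longer
prefixes with V. The only obstacle is a pair x, y whose first occurrences in a block come in
opposite orders. If no earlier block contains both, their earlier occurrences form d runs. For d ≤ n
these runs map onto a piece of `vWord n` and the two orders are distinguished (`Rho.runs_false`);
for d > n they contain an alternating subword of length n + 1, and σₙ₊₁ exchanges x and y
(`IsE1Sigma.hasAlt_swap`).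

Hence the identities of the Rees quotient, those respecting the β-class under all substitutions and
contexts, and those of 𝔼¹{σₙ₊₁} coincide, which gives both claims. -/

namespace MonVar

/-! ### The automaton of the β-class of `vWord n` -/

/-- The letter `a` or `b` that precedes `t (k + 1)` in `vWord (k + 1)`. -/
def cl (k : ℕ) : ℕ := if Even k then 0 else 1

/-- States of the automaton recognising the words `β`-equivalent to `vWord n`. -/
inductive St
  | dead
  | pre (k : ℕ) (f : Bool)
  | l0
  | l1
  | ok

/-- The initial state for `vWord n`. -/
def start : ℕ → St
  | 0 => .l0
  | k + 1 => .pre k false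

/-- The transition function. -/
def step : St → ℕ → St
  | .dead, _ => .dead
  | .pre k f, l => if l = cl k then .pre k true else if l = k + 3 ∧ f = true then start k else .dead
  | .l0, l => if l = 1 then .l1 else .dead
  | .l1, l => if l = 1 then .l1 else if l = 0 then .ok else .dead
  | .ok, l => if l ≤ 1 then .ok else .dead

/-- The state reached from `q` after reading `w`. -/
def run (q : St) (w : List ℕ) : St := w.foldl step q

/-- The words that turn out to form the `β`-class of `vWord n`. -/
def InV (n : ℕ) (w : List ℕ) : Prop := run (start n) w = .ok ∧ 2 ≤ w.count 1

/-- The number of letters `t k` still to be read. -/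
def level : St → ℕ
  | .pre k _ => k + 1
  | _ => 0

theorem cl_le (k : ℕ) : cl k ≤ 1 := by unfold cl; split <;> simp

theorem cl_add_two (k : ℕ) : cl (k + 2) = cl k := by
  unfold cl; simp [Nat.even_add]

@[simp] theorem cl_zero : cl 0 = 0 := by simp [cl]

@[simp] theorem run_nil (q : St) : run q [] = q := rfl

@[simp] theorem run_cons (q : St) (l : ℕ) (w : List ℕ) : run q (l :: w) = run (step q l) w := rfl

@[simp] theorem run_append (q : St) (v w : List ℕ) : run q (v ++ w) = run (run q v) w := by
  simp [run]

@[simp] theorem run_dead (w : List ℕ) : run .dead w = .dead := by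
  induction w with
  | nil => rfl
  | cons l w ih => exact ih

@[simp] theorem level_pre (k : ℕ) (f : Bool) : level (.pre k f) = k + 1 := rfl

@[simp] theorem level_start (k : ℕ) : level (start k) = k := by cases k <;> rfl

theorem level_step_le (q : St) (l : ℕ) : level (step q l) ≤ level q := by
  cases q <;> simp only [step] <;> (repeat' split) <;> first | (simp; done) | simp [level]

theorem level_run_le (q : St) (w : List ℕ) : level (run q w) ≤ level q := by
  induction w generalizing q with
  | nil => exact le_rfl
  | cons l w ih => exact (ih _).trans (level_step_le q l)

theorem step_step_self (q : St) {c : ℕ} (hc : c ≤ 1) : step (step q c) c = step q c := by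
  have h3 : ∀ k, c ≠ k + 3 := fun k => by omega
  cases q with
  | dead => rfl
  | pre k f =>
    by_cases h : c = cl k
    · simp [step, h]
    · simp [step, h, h3]
  | l0 => interval_cases c <;> rfl
  | l1 => interval_cases c <;> rfl
  | ok => interval_cases c <;> rfl

/-- Reading a further `a` or `b` either changes nothing or leads to `ok` or `dead`, where both
letters loop. -/
theorem step_fixed {q : St} {c d : ℕ} (hc : c ≤ 1) (hd : d ≤ 1) (h : step q c = q) :
    step (step q d) c = step q d := by
  have h3 : ∀ k, d ≠ k + 3 := fun k => by omega
  have h3 : ∀ k, c ≠ k + 3 := fun k => by omega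
  cases q with
  | dead => rfl
  | pre k f =>
    by_cases h' : c = cl k
    · by_cases h2 : d = cl k
      · simp [step, h', h2]
      · simp [step, *]
    · simp [step, *] at h
  | l0 => interval_cases c <;> simp [step] at h
  | l1 => interval_cases c <;> interval_cases d <;> first | rfl | simp [step] at h
  | ok => interval_cases c <;> interval_cases d <;> rfl

theorem run_fixed {q : St} {c : ℕ} (hc : c ≤ 1) {D : List ℕ} (hD : ∀ d ∈ D, d ≤ 1)
    (h : step q c = q) : step (run q D) c = run q D := by
  induction D generalizing q with
  | nil => exact h
  | cons d D ih =>
    exact ih (fun e he => hD e (List.mem_cons_of_mem _ he))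
      (step_fixed hc (hD d List.mem_cons_self) h)

theorem step_run_of_mem (q : St) {c : ℕ} {D : List ℕ} (hD : ∀ d ∈ D, d ≤ 1) (h : c ∈ D) :
    step (run q D) c = run q D := by
  obtain ⟨D₁, D₂, rfl⟩ := List.append_of_mem h
  rw [run_append, run_cons]
  exact run_fixed (hD c h) (fun d hd => hD d (by simp [hd]))
    (step_step_self _ (hD c h))

/-- Letters `a`, `b` that have already been read since the last `t k` may be read again. -/
theorem run_absorb (q : St) {C D : List ℕ} (hD : ∀ d ∈ D, d ≤ 1) (h : ∀ c ∈ C, c ∈ D) :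
    run q (D ++ C) = run q D := by
  induction C with
  | nil => simp
  | cons c C ih =>
    rw [run_append, run_cons, step_run_of_mem q hD (h c List.mem_cons_self), ← run_append]
    exact ih fun e he => h e (List.mem_cons_of_mem _ he)

/-- Every t-letter at or below the current level must be read exactly once; the letter `2` (that is,
`t 0`) and those above the level kill the run. So only `a` and `b` can repeat in an accepted word.
-/
theorem count_of_run {q : St} {w : List ℕ} (h : run q w = .ok) {l : ℕ} (hl : 2 ≤ l) :
    (3 ≤ l ∧ l ≤ level q + 2 ∧ w.count l = 1) ∨ (¬ (3 ≤ l ∧ l ≤ level q + 2) ∧ w.count l = 0) := by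
  induction w generalizing q with
  | nil =>
    have hq : q = .ok := h
    subst hq
    right; simp [level]; omega
  | cons m w ih =>
    have := ih h
    rw [List.count_cons]
    cases q with
    | dead => simp [step] at h
    | pre k f =>
      by_cases h1 : m = cl k
      · have hk := cl_le k
        have h3 : cl k ≠ l := by omega
        simpa [step, h1, h3] using this
      · by_cases h2 : m = k + 3 ∧ f = true
        · obtain ⟨rfl, rfl⟩ := h2
          simp only [step, h1, if_false, and_self, if_true, level_start, level_pre,
            beq_iff_eq] at this ⊢
          split_ifs <;> omega
        · simp [step, h1, h2] at h
    | l0 =>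
      by_cases h1 : m = 1
      · have h2 : m ≠ l := by omega
        subst h1; simpa [step, level, h2] using this
      · simp [step, h1] at h
    | l1 =>
      by_cases h1 : m ≤ 1
      · have h2 : m ≠ l := by omega
        interval_cases m <;> simpa [step, level, h2] using this
      · have h0 : m ≠ 0 := by omega
        have h01 : m ≠ 1 := by omega
        simp [step, h0, h01] at h
    | ok =>
      by_cases h1 : m ≤ 1
      · have h2 : m ≠ l := by omega
        simpa [step, level, h1, h2] using this
      · simp [step, h1] at h

theorem le_one_of_run {q : St} {w : List ℕ} (h : run q w = .ok) {l : ℕ} (hl : 2 ≤ w.count l) :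
    l ≤ 1 := by
  by_contra hc
  have := count_of_run h (l := l) (by omega)
  omega

theorem InV.count_three {n : ℕ} (hn : 1 ≤ n) {w : List ℕ} (h : InV n w) : w.count 3 = 1 := by
  have := count_of_run h.1 (l := 3) (by norm_num)
  rw [level_start] at this
  omega

theorem eq_of_step_pre {q : St} {l k : ℕ} (h : step q l = .pre k true) :
    l = cl k ∧ ∃ f, q = .pre k f := by
  cases q with
  | dead => simp [step] at h
  | pre j f =>
    simp only [step] at h
    split_ifs at h with h1 h2
    · obtain ⟨rfl⟩ := h; exact ⟨h1, f, rfl⟩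
    · cases j <;> simp [start] at h
  | l0 => simp only [step] at h; split_ifs at h
  | l1 => simp only [step] at h; split_ifs at h
  | ok => simp only [step] at h; split_ifs at h

theorem eq_of_step_ne_dead {q : St} {l : ℕ} (hl : 2 ≤ l) (h : step q l ≠ .dead) :
    ∃ k, q = .pre k true ∧ l = k + 3 := by
  cases q with
  | dead => simp [step] at h
  | pre j f =>
    have := cl_le j
    simp only [step] at h
    split_ifs at h with h1 h2
    · omega
    · exact ⟨j, by rw [h2.2], h2.1⟩
    · exact absurd rfl h
  | l0 => simp only [step] at h; split_ifs at h <;> first | omega | exact absurd rfl h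
  | l1 => simp only [step] at h; split_ifs at h <;> first | omega | exact absurd rfl h
  | ok => simp only [step] at h; split_ifs at h <;> first | omega | exact absurd rfl h

theorem last_of_run_pre {n k : ℕ} {A : List ℕ} (h : run (start n) A = .pre k true) :
    ∃ A', A = A' ++ [cl k] := by
  rcases List.eq_nil_or_concat' A with rfl | ⟨A', l, rfl⟩
  · cases n <;> simp [start] at h
  · rw [run_append] at h
    exact ⟨A', by rw [(eq_of_step_pre h).1]⟩

/-- The letter `3`, that is `t 1`, is the probe of the later substitutions: its two neighbours in an
accepted word are forced. -/
theorem pre_of_run_three {q : St} {A W : List ℕ} (h : run q (A ++ 3 :: W) = .ok) :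
    run q A = .pre 0 true ∧ run .l0 W = .ok := by
  rw [run_append, run_cons] at h
  obtain ⟨k, hk, h3⟩ := eq_of_step_ne_dead (q := run q A) (l := 3) (by norm_num)
    (by intro h'; rw [h', run_dead] at h; cases h)
  obtain rfl : k = 0 := by omega
  rw [hk] at h
  exact ⟨hk, by simpa [step, start] using h⟩

/-- The letter before `t₁` is `a`. -/
theorem InV.last_eq {n : ℕ} {A W : List ℕ} (h : InV n (A ++ 3 :: W)) : ∃ A', A = A' ++ [0] := by
  simpa using last_of_run_pre (pre_of_run_three h.1).1

/-- The letter after `t₁` is `b`. -/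
theorem InV.head_eq {n : ℕ} {A W : List ℕ} (h : InV n (A ++ 3 :: W)) : ∃ W', W = 1 :: W' := by
  have := (pre_of_run_three h.1).2
  cases W with
  | nil => cases this
  | cons l W =>
    by_cases h1 : l = 1
    · exact ⟨W, by rw [h1]⟩
    · simp [step, h1] at this

theorem run_ok {W : List ℕ} (h : ∀ l ∈ W, l ≤ 1) : run .ok W = .ok := by
  induction W with
  | nil => rfl
  | cons l W ih =>
    rw [run_cons]
    simpa [step, h l List.mem_cons_self] using ih fun e he => h e (List.mem_cons_of_mem _ he)

theorem run_l1 {W : List ℕ} (h : ∀ l ∈ W, l ≤ 1) (h0 : 0 ∈ W) : run .l1 W = .ok := by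
  induction W with
  | nil => simp at h0
  | cons l W ih =>
    have hl := h l List.mem_cons_self
    have hW : ∀ e ∈ W, e ≤ 1 := fun e he => h e (List.mem_cons_of_mem _ he)
    interval_cases l
    · simpa [step] using run_ok hW
    · simpa [step] using ih hW (by simpa using h0)

theorem run_l0 {W : List ℕ} (h : ∀ l ∈ W, l ≤ 1) (h0 : 0 ∈ W) : run .l0 (1 :: W) = .ok := by
  simpa [step] using run_l1 h h0

theorem le_one_of_run_ok {W : List ℕ} (h : run .ok W = .ok) : ∀ l ∈ W, l ≤ 1 := by
  induction W with
  | nil => simp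
  | cons l W ih =>
    by_cases hl : l ≤ 1
    · simp only [run_cons, step, hl, if_true] at h
      simpa [hl] using ih h
    · simp [step, hl] at h

theorem of_run_l1 {W : List ℕ} (h : run .l1 W = .ok) :
    ∃ j W', W = List.replicate j 1 ++ 0 :: W' ∧ ∀ l ∈ W', l ≤ 1 := by
  induction W with
  | nil => cases h
  | cons l W ih =>
    by_cases h1 : l = 1
    · subst h1
      obtain ⟨j, W', rfl, hW⟩ := ih (by simpa [step] using h)
      exact ⟨j + 1, W', by simp [List.replicate_succ], hW⟩
    · by_cases h0 : l = 0
      · subst h0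
        exact ⟨0, W, by simp, le_one_of_run_ok (by simpa [step] using h)⟩
      · simp [step, h1, h0] at h

theorem of_run_l0 {W : List ℕ} (h : run .l0 W = .ok) :
    ∃ j W', W = 1 :: List.replicate j 1 ++ 0 :: W' ∧ ∀ l ∈ W', l ≤ 1 := by
  cases W with
  | nil => cases h
  | cons l W =>
    by_cases h1 : l = 1
    · subst h1
      obtain ⟨j, W', rfl, hW⟩ := of_run_l1 (W := W) (by simpa [step] using h)
      exact ⟨j, W', by simp, hW⟩
    · simp [step, h1] at h

theorem of_run_pre {k : ℕ} {f : Bool} {W : List ℕ} (h : run (.pre k f) W = .ok) :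
    ∃ j W', W = List.replicate j (cl k) ++ (k + 3) :: W' ∧ (f = false → 1 ≤ j) ∧
      run (start k) W' = .ok := by
  induction W generalizing f with
  | nil => cases h
  | cons l W ih =>
    by_cases h1 : l = cl k
    · subst h1
      obtain ⟨j, W', rfl, -, hW⟩ := ih (f := true) (by simpa [step] using h)
      exact ⟨j + 1, W', by simp [List.replicate_succ], by simp, hW⟩
    · by_cases h2 : l = k + 3 ∧ f = true
      · obtain ⟨rfl, rfl⟩ := h2
        exact ⟨0, W, by simp, by simp, by simpa [step, h1] using h⟩
      · simp [step, h1, h2] at h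

theorem run_replicate {k : ℕ} {f : Bool} {j : ℕ} (hj : 1 ≤ j) :
    run (.pre k f) (List.replicate j (cl k)) = .pre k true := by
  induction j generalizing f with
  | zero => omega
  | succ j ih =>
    rw [List.replicate_succ, run_cons]
    rcases Nat.eq_zero_or_pos j with rfl | h
    · simp [step]
    · simpa [step] using ih h

theorem step_t (k : ℕ) : step (.pre k true) (k + 3) = start k := by
  have := cl_le k
  have h : k + 3 ≠ cl k := by omega
  simp [step, h]

/-- Prefixes lead from the initial state for `n` to the one for any `e ≤ n`. -/
theorem exists_prefix {n e : ℕ} (h : e ≤ n) : ∃ L, run (start n) L = start e := by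
  induction n with
  | zero => exact ⟨[], by obtain rfl : e = 0 := by omega
                          rfl⟩
  | succ n ih =>
    rcases Nat.lt_or_ge n e with h' | h'
    · exact ⟨[], by obtain rfl : e = n + 1 := by omega
                    rfl⟩
    · obtain ⟨L, hL⟩ := ih h'
      exact ⟨cl n :: (n + 3) :: L, by
        have h1 : step (start (n + 1)) (cl n) = .pre n true := by simp [start, step]
        rw [run_cons, run_cons, h1, step_t, hL]⟩

/-! ### Rewriting in monoids of 𝔼¹ -/

section E1Monoids

variable {N : Type u} [Monoid N]

/-- The defining identities of `𝔼¹`, for a monoid `N`. -/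
structure IsE1 (N : Type u) [Monoid N] : Prop where
  sq_right : ∀ x s : N, x * s * x = x * s * x ^ 2
  sq_left : ∀ x s : N, x * s * x = x ^ 2 * s * x
  sandwich : ∀ x y : N, x * y ^ 2 * x = x ^ 2 * y ^ 2

/-- The value of a word in a monoid. -/
def ev (g : ℕ → N) (w : List ℕ) : N := (w.map g).prod

theorem lift_eq_ev (g : ℕ → N) (w : Word) : FreeMonoid.lift g w = ev g w.toList :=
  FreeMonoid.lift_apply g w

theorem mem_E1_iff : E1.{u}.Mem N ↔ IsE1 N := by
  constructor
  · intro h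
    have h1 : ∀ x s : N, x * s * x = x * s * x ^ 2 := fun x s => by
      have := h (a * t 1 * a, a * t 1 * a ^ 2) (Or.inl rfl) (fun i => if i = 0 then x else s)
      rw [lift_eq_ev, lift_eq_ev] at this
      change ev _ [0, 3, 0] = ev _ [0, 3, 0, 0] at this
      simpa [ev, pow_two, mul_assoc] using this
    refine ⟨h1, fun x s => (h1 x s).trans ?_, fun x y => ?_⟩
    · have := h (a * t 1 * a ^ 2, a ^ 2 * t 1 * a) (Or.inr (Or.inl rfl))
        (fun i => if i = 0 then x else s)
      rw [lift_eq_ev, lift_eq_ev] at this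
      change ev _ [0, 3, 0, 0] = ev _ [0, 0, 3, 0] at this
      simpa [ev, pow_two, mul_assoc] using this
    · have := h (a * b ^ 2 * a, a ^ 2 * b ^ 2) (Or.inr (Or.inr rfl))
        (fun i => if i = 0 then x else y)
      rw [lift_eq_ev, lift_eq_ev] at this
      change ev _ [0, 1, 1, 0] = ev _ [0, 0, 1, 1] at this
      simpa [ev, pow_two, mul_assoc] using this
  · rintro ⟨h1, h2, h3⟩ p hp f
    simp only [E1Identities, Set.mem_insert_iff, Set.mem_singleton_iff] at hp
    rw [lift_eq_ev, lift_eq_ev]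
    rcases hp with rfl | rfl | rfl
    · change ev _ [0, 3, 0] = ev _ [0, 3, 0, 0]
      simpa [ev, pow_two, mul_assoc] using h1 (f 0) (f 3)
    · change ev _ [0, 3, 0, 0] = ev _ [0, 0, 3, 0]
      simpa [ev, pow_two, mul_assoc] using (h1 (f 0) (f 3)).symm.trans (h2 _ _)
    · change ev _ [0, 1, 1, 0] = ev _ [0, 0, 1, 1]
      simpa [ev, pow_two, mul_assoc] using h3 (f 0) (f 1)

variable (g : ℕ → N)

@[simp] theorem ev_nil : ev g [] = 1 := rfl

@[simp] theorem ev_cons (l : ℕ) (w : List ℕ) : ev g (l :: w) = g l * ev g w := by simp [ev]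

@[simp] theorem ev_append (v w : List ℕ) : ev g (v ++ w) = ev g v * ev g w := by simp [ev]

theorem ev_flatMap (φ : ℕ → List ℕ) (w : List ℕ) :
    ev g (w.flatMap φ) = ev (fun i => ev g (φ i)) w := by
  induction w with
  | nil => rfl
  | cons l w ih => simp [ih]

theorem ev_congr {g h : ℕ → N} {w : List ℕ} (H : ∀ l ∈ w, g l = h l) : ev g w = ev h w := by
  unfold ev; rw [List.map_congr_left H]

theorem IsE1.pow_three (hN : IsE1 N) (x : N) : x ^ 3 = x ^ 2 := by
  have := hN.sq_left x 1
  simpa [pow_succ, pow_two] using this.symm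

theorem IsE1.pow_add_two (hN : IsE1 N) (x : N) (j : ℕ) : x ^ (j + 2) = x ^ 2 := by
  induction j with
  | zero => rfl
  | succ j ih => rw [show j + 1 + 2 = (j + 2) + 1 by ring, pow_succ, ih, ← pow_succ, hN.pow_three]

/-- Another occurrence of `x`, on either side, plays the outer `x` of xtx ≈ xtx² ≈ x²tx. -/
theorem IsE1.ev_sq (hN : IsE1 N) {x : ℕ} {A B : List ℕ} (h : x ∈ A ∨ x ∈ B) :
    ev g (A ++ x :: x :: B) = ev g (A ++ x :: B) := by
  rcases h with h | h
  · obtain ⟨A₁, A₂, rfl⟩ := List.append_of_mem h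
    have := hN.sq_right (g x) (ev g A₂)
    simp only [ev_append, ev_cons, mul_assoc, pow_two] at this ⊢
    simp only [← mul_assoc] at this ⊢
    rw [mul_assoc (ev g A₁), mul_assoc (ev g A₁), mul_assoc (ev g A₁), ← this]
  · obtain ⟨B₁, B₂, rfl⟩ := List.append_of_mem h
    have := hN.sq_left (g x) (ev g B₁)
    simp only [ev_append, ev_cons, pow_two, ← mul_assoc] at this ⊢
    rw [mul_assoc (ev g A), mul_assoc (ev g A), mul_assoc (ev g A), ← this]
    simp only [mul_assoc]

/-- Squaring every letter of a block brings it to the form in which xy²x ≈ x²y² can act. -/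
theorem IsE1.ev_squares (hN : IsE1 N) {A M B : List ℕ}
    (h : ∀ d ∈ M, 2 ≤ (A ++ M ++ B).count d) :
    ev g (A ++ M ++ B) = ev g A * (M.map fun i => g i ^ 2).prod * ev g B := by
  induction M generalizing A with
  | nil => simp
  | cons y M ih =>
    have hy : y ∈ A ∨ y ∈ M ++ B := by
      by_contra hc
      simp only [List.mem_append, not_or] at hc
      have := h y List.mem_cons_self
      simp [List.count_eq_zero_of_not_mem hc.1, List.count_eq_zero_of_not_mem hc.2.1,
        List.count_eq_zero_of_not_mem hc.2.2] at this
    have h1 := hN.ev_sq g hy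
    have h2 := ih (A := A ++ [y, y]) (fun d hd => by
      have := h d (List.mem_cons_of_mem _ hd)
      simp only [List.count_append, List.count_cons, List.count_nil] at this ⊢
      omega)
    simp only [List.append_assoc, List.cons_append, List.nil_append] at h1 h2 ⊢
    rw [← h1, h2]
    simp [pow_two, mul_assoc]

/-- To pass a last factor y², a copy of `x` is first produced before it by induction; then xy²x ≈
x²y² moves the trailing `x` there, where it is absorbed. -/
theorem IsE1.squares_mul (hN : IsE1 N) {x : ℕ} {M : List ℕ} (h : x ∈ M) :
    (M.map fun i => g i ^ 2).prod * g x = (M.map fun i => g i ^ 2).prod := by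
  obtain ⟨M₁, M₂, rfl⟩ := List.append_of_mem h
  have key : g x ^ 2 * (M₂.map fun i => g i ^ 2).prod * g x
      = g x ^ 2 * (M₂.map fun i => g i ^ 2).prod := by
    clear h
    induction M₂ using List.reverseRecOn with
    | nil => simpa [← pow_succ] using hN.pow_three (g x)
    | append_singleton M y ih =>
      set m := (M.map fun i => g i ^ 2).prod
      have e : ((M ++ [y]).map fun i => g i ^ 2).prod = m * g y ^ 2 := by simp [m]
      have ih2 : g x ^ 2 * m * g x ^ 2 = g x ^ 2 * m := by rw [pow_two (g x), ← mul_assoc,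
        ← pow_two (g x), ih, ih]
      rw [e]
      calc g x ^ 2 * (m * g y ^ 2) * g x
          = (g x ^ 2 * m) * g y ^ 2 * g x := by simp only [mul_assoc]
        _ = (g x ^ 2 * m * g x) * g y ^ 2 * g x := by rw [ih]
        _ = g x ^ 2 * m * (g x * g y ^ 2 * g x) := by simp only [mul_assoc]
        _ = g x ^ 2 * m * g x ^ 2 * g y ^ 2 := by rw [hN.sandwich]; simp only [mul_assoc]
        _ = g x ^ 2 * (m * g y ^ 2) := by rw [ih2]; simp only [mul_assoc]
  simp only [List.map_append, List.map_cons, List.prod_append, List.prod_cons] at key ⊢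
  rw [← mul_assoc]
  simp only [mul_assoc] at key ⊢
  rw [key]

/-- Between consecutive simple letters, only the order of first occurrences matters. -/
theorem IsE1.ev_absorb (hN : IsE1 N) {A D C B : List ℕ} (hC : ∀ c ∈ C, c ∈ D)
    (hD : ∀ d ∈ D, 2 ≤ (A ++ D ++ B).count d) :
    ev g (A ++ D ++ C ++ B) = ev g (A ++ D ++ B) := by
  have key : ∀ C : List ℕ, (∀ c ∈ C, c ∈ D) →
      (D.map fun i => g i ^ 2).prod * ev g C = (D.map fun i => g i ^ 2).prod := by
    intro C hC
    induction C with
    | nil => simp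
    | cons c C ih =>
      rw [ev_cons, ← mul_assoc, hN.squares_mul g (hC c List.mem_cons_self)]
      exact ih fun e he => hC e (List.mem_cons_of_mem _ he)
  rw [hN.ev_squares g hD, List.append_assoc (A ++ D), hN.ev_squares g, ev_append, mul_assoc,
    ← mul_assoc _ (ev g C), key C hC, mul_assoc]
  intro d hd
  have := hD d hd
  simp only [List.count_append] at this ⊢
  omega

end E1Monoids

/-! ### The β-class of `vWord n` is the language of the automaton -/

theorem toList_t (k : ℕ) : FreeMonoid.toList (t k) = [k + 2] := rfl

theorem toList_cl (k : ℕ) : FreeMonoid.toList (if Even k then a else b) = [cl k] := by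
  unfold cl; split <;> rfl

theorem toList_vWord_zero : (vWord 0).toList = [1, 1, 0, 0] := rfl

theorem toList_vWord_succ (k : ℕ) :
    (vWord (k + 1)).toList = cl k :: (k + 3) :: (vWord k).toList := by
  rw [vWord, FreeMonoid.toList_mul, FreeMonoid.toList_mul, toList_cl, toList_t]; rfl

theorem toList_uWord_succ (k : ℕ) :
    (uWord (k + 1)).toList = cl k :: (k + 3) :: (uWord k).toList := by
  rw [uWord, FreeMonoid.toList_mul, FreeMonoid.toList_mul, toList_cl, toList_t]; rfl

theorem run_vWord (n : ℕ) : run (start n) (vWord n).toList = .ok := by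
  induction n with
  | zero => simp [toList_vWord_zero, start, step]
  | succ n ih =>
    have h1 : step (start (n + 1)) (cl n) = .pre n true := by simp [start, step]
    rw [toList_vWord_succ, run_cons, run_cons, h1, step_t, ih]

theorem count_vWord (n : ℕ) : 2 ≤ (vWord n).toList.count 1 := by
  induction n with
  | zero => simp [toList_vWord_zero]
  | succ n ih => rw [toList_vWord_succ, List.count_cons, List.count_cons]; omega

theorem inV_vWord (n : ℕ) : InV n (vWord n).toList := ⟨run_vWord n, count_vWord n⟩

theorem mem_of_run_start {k : ℕ} {W : List ℕ} (h : run (start k) W = .ok) {c : ℕ} (hc : c ≤ 1) :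
    c ∈ W := by
  induction k generalizing W with
  | zero =>
    obtain ⟨j, W', rfl, -⟩ := of_run_l0 h
    interval_cases c <;> simp
  | succ k ih =>
    obtain ⟨j, W', rfl, -, h'⟩ := of_run_pre h
    simp [ih h']

/-- A word accepted by the automaton has the value of `vWord k` in context. -/
theorem IsE1.ev_of_run {N : Type u} [Monoid N] (hN : IsE1 N) (g : ℕ → N) {k : ℕ} {A W : List ℕ}
    (h : run (start k) W = .ok) (hA : 0 ∈ A ∨ 1 ≤ k) (hc : 2 ≤ (A ++ W).count 1) :
    ev g (A ++ W) = ev g (A ++ (vWord k).toList) := by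
  induction k generalizing A W with
  | zero =>
    replace hA : 0 ∈ A := by simpa using hA
    obtain ⟨j, W', rfl, hW⟩ := of_run_l0 h
    have c0 : 1 ≤ A.count 0 := List.count_pos_iff.2 hA
    -- Doubling the first `b` makes the exponent at least 2, so that it collapses to b² even when j
    -- = 0; `hc` provides the other `b` this requires.
    have e1 : ev g (A ++ (1 :: List.replicate j 1 ++ 0 :: W'))
        = ev g (A ++ (1 :: 1 :: List.replicate j 1 ++ 0 :: W')) := by
      have : 1 ∈ A ∨ 1 ∈ List.replicate j 1 ++ 0 :: W' := by
        by_contra hc'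
        simp only [not_or] at hc'
        rw [List.count_append, List.cons_append, List.count_cons,
          List.count_eq_zero_of_not_mem hc'.1, List.count_eq_zero_of_not_mem hc'.2] at hc
        simp at hc
      exact (hN.ev_sq g this).symm
    have e2 := hN.ev_absorb g (A := A) (D := 1 :: 1 :: List.replicate j 1 ++ [0]) (C := W')
      (B := []) (fun c hc => by
        have := hW c hc
        interval_cases c <;> simp) (fun d hd => by
        have : d = 0 ∨ d = 1 := by
          simp only [List.cons_append, List.mem_cons, List.mem_append, List.mem_replicate,
            List.not_mem_nil, or_false] at hd
          omega
        rcases this with rfl | rfl <;>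
          simp [List.count_append] <;> omega)
    have e3 := hN.ev_sq g (x := 0) (A := A ++ [1, 1]) (B := []) (by simp [hA])
    have e4 : ev g (1 :: 1 :: List.replicate j 1) = g 1 ^ 2 := by
      have := hN.pow_add_two (g 1) j
      have h' : ev g (List.replicate j 1) = g 1 ^ j := by simp [ev]
      rw [ev_cons, ev_cons, h', ← this, pow_succ', pow_succ']
    have e5 : A ++ (1 :: 1 :: List.replicate j 1 ++ 0 :: W')
      = A ++ (1 :: 1 :: List.replicate j 1 ++ [0]) ++ W' ++ [] := by simp
    rw [e1, e5, e2, toList_vWord_zero]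
    rw [ev_append, ev_append, ev_append, e4]
    simp only [ev_append, ev_cons, ev_nil, mul_one, pow_two, mul_assoc] at e3 ⊢
    exact e3.symm
  | succ k ih =>
    obtain ⟨j, W', rfl, hj, hW⟩ := of_run_pre h
    have hk : cl k ∈ W' := mem_of_run_start hW (cl_le k)
    obtain ⟨i, rfl⟩ : ∃ i, j = i + 1 := ⟨j - 1, by have := hj rfl; omega⟩
    have e1 : ∀ i, ev g (A ++ (List.replicate (i + 1) (cl k) ++ (k + 3) :: W'))
        = ev g (A ++ (cl k :: (k + 3) :: W')) := by
      intro i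
      induction i with
      | zero => simp
      | succ i ihi =>
        rw [← ihi, List.replicate_succ, List.replicate_succ]
        exact hN.ev_sq g (by simp [hk])
    rw [e1, toList_vWord_succ]
    have := ih (A := A ++ [cl k, k + 3]) hW ?_ ?_
    · simpa using this
    · rcases Nat.eq_zero_or_pos k with rfl | h'
      · simp
      · right; exact h'
    · simp only [List.count_append, List.count_cons, List.count_nil, List.count_replicate] at hc ⊢
      by_cases h1 : cl k = 1
      · have : 1 ≤ W'.count 1 := List.count_pos_iff.2 (h1 ▸ hk)
        simp [h1]; omega
      · simp [h1] at hc ⊢; omega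

theorem InV.ev_eq {N : Type u} [Monoid N] (hN : IsE1 N) (g : ℕ → N) {n : ℕ} (hn : 1 ≤ n)
    {W : List ℕ} (h : InV n W) : ev g W = ev g (vWord n).toList := by
  simpa using hN.ev_of_run g (A := []) h.1 (Or.inr hn) (by simpa using h.2)

/-- The syntactic congruence of the language `InV n`. -/
def synCon (n : ℕ) : Con Word where
  r v w := ∀ p s : Word, InV n (p * v * s).toList ↔ InV n (p * w * s).toList
  iseqv :=
    { refl := fun _ _ _ => Iff.rfl
      symm := fun h p s => (h p s).symm
      trans := fun h h' p s => (h p s).trans (h' p s) }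
  mul' := by
    intro v v' w w' h h' p s
    have h1 := h p (w * s)
    have h2 := h' (p * v') s
    simp only [mul_assoc] at h1 h2 ⊢
    exact h1.trans h2

theorem run_context (q : St) {P D C S : List ℕ} (hD : ∀ d ∈ D, d ≤ 1) (hC : ∀ c ∈ C, c ∈ D) :
    run q (P ++ D ++ C ++ S) = run q (P ++ D ++ S) := by
  have := run_absorb (run q P) hD hC
  simp only [run_append] at this ⊢
  rw [this]

/-- An accepted word repeats only `a` and `b`, so acceptance of either side already confines the
repeated letters `A` to these; only then do the two runs have to be compared. -/
theorem inV_iff_of {n : ℕ} {v w A : List ℕ} (hv : ∀ c ∈ A, 2 ≤ v.count c)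
    (hw : ∀ c ∈ A, 2 ≤ w.count c) (hr : (∀ c ∈ A, c ≤ 1) → ∀ q, run q v = run q w)
    (hc : 2 ≤ v.count 1 ↔ 2 ≤ w.count 1) : InV n v ↔ InV n w := by
  constructor
  · rintro ⟨h1, h2⟩
    exact ⟨by rw [← hr fun c hc => le_one_of_run h1 (hv c hc)]; exact h1, hc.1 h2⟩
  · rintro ⟨h1, h2⟩
    exact ⟨by rw [hr fun c hc => le_one_of_run h1 (hw c hc)]; exact h1, hc.2 h2⟩

theorem inV_sq_right (n : ℕ) (P A T S : List ℕ) :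
    InV n (P ++ A ++ T ++ A ++ S) ↔ InV n (P ++ A ++ T ++ A ++ A ++ S) := by
  refine inV_iff_of (A := A) ?_ ?_ ?_ ?_
  · intro c hc; have := List.count_pos_iff.2 hc; simp only [List.count_append]; omega
  · intro c hc; have := List.count_pos_iff.2 hc; simp only [List.count_append]; omega
  · intro hA q; exact (run_context q hA fun _ h => h).symm
  · simp only [List.count_append]; omega

theorem inV_sq_left (n : ℕ) (P A T S : List ℕ) :
    InV n (P ++ A ++ T ++ A ++ S) ↔ InV n (P ++ A ++ A ++ T ++ A ++ S) := by
  refine inV_iff_of (A := A) ?_ ?_ ?_ ?_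
  · intro c hc; have := List.count_pos_iff.2 hc; simp only [List.count_append]; omega
  · intro c hc; have := List.count_pos_iff.2 hc; simp only [List.count_append]; omega
  · intro hA q
    have := run_context q (P := P) (S := T ++ A ++ S) hA fun _ h => h
    simpa only [List.append_assoc] using this.symm
  · simp only [List.count_append]; omega

theorem inV_sandwich (n : ℕ) (P A B S : List ℕ) :
    InV n (P ++ A ++ B ++ B ++ A ++ S) ↔ InV n (P ++ A ++ A ++ B ++ B ++ S) := by
  refine inV_iff_of (A := A ++ B) ?_ ?_ ?_ ?_
  · intro c hc
    rw [List.mem_append] at hc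
    rcases hc with hc | hc <;>
      (have := List.count_pos_iff.2 hc; simp only [List.count_append]; omega)
  · intro c hc
    rw [List.mem_append] at hc
    rcases hc with hc | hc <;>
      (have := List.count_pos_iff.2 hc; simp only [List.count_append]; omega)
  · intro hA q
    have h1 := run_context q (P := P) (D := A ++ B ++ B) (C := A) (S := S)
      (fun d hd => hA d (by simpa using hd)) (by simp +contextual)
    have h2 := run_context q (P := P) (D := A) (C := A) (S := B ++ B ++ S)
      (fun d hd => hA d (by simp [hd])) (by simp)
    simp only [← List.append_assoc] at h1 h2 ⊢
    rw [h1, h2]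
  · simp only [List.count_append]; omega

theorem isE1_synCon (n : ℕ) : IsE1 (synCon n).Quotient := by
  constructor
  · intro x s
    induction x using Con.induction_on with | _ x
    induction s using Con.induction_on with | _ s
    rw [pow_two]
    simp only [← Con.coe_mul]
    rw [Con.eq]
    intro p q
    simpa [FreeMonoid.toList_mul, pow_two] using inV_sq_right n p.toList x.toList s.toList q.toList
  · intro x s
    induction x using Con.induction_on with | _ x
    induction s using Con.induction_on with | _ s
    rw [pow_two]
    simp only [← Con.coe_mul]
    rw [Con.eq]
    intro p q
    simpa [FreeMonoid.toList_mul, pow_two] using inV_sq_left n p.toList x.toList s.toList q.toList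
  · intro x y
    induction x using Con.induction_on with | _ x
    induction y using Con.induction_on with | _ y
    rw [pow_two, pow_two]
    simp only [← Con.coe_mul]
    rw [Con.eq]
    intro p q
    simpa [FreeMonoid.toList_mul, pow_two] using inV_sandwich n p.toList x.toList y.toList q.toList

theorem lift_mk_eq (c : Con Word) (w : Word) :
    FreeMonoid.lift (fun i => ((FreeMonoid.of i : Word) : c.Quotient)) w = (w : c.Quotient) := by
  have : FreeMonoid.lift (fun i => ((FreeMonoid.of i : Word) : c.Quotient)) = c.mk' :=
    FreeMonoid.hom_eq fun i => by simp
  rw [this]; rfl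

/-- The syntactic monoid lies in 𝔼¹ and separates the language from its complement; the converse is
the normal form `InV.ev_eq`. For n = 0 this fails: b²a is accepted. -/
theorem mem_betaClass_iff {n : ℕ} (hn : 1 ≤ n) (w : Word) :
    w ∈ betaClass (vWord n) ↔ InV n w.toList := by
  constructor
  · intro h
    have h1 : Satisfies (synCon n).Quotient (vWord n) w :=
      h (synCon n).Quotient (mem_E1_iff.2 (isE1_synCon n))
    have h2 := h1 fun i => ((FreeMonoid.of i : Word) : (synCon n).Quotient)
    rw [lift_mk_eq, lift_mk_eq, Con.eq] at h2
    have h3 := h2 1 1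
    simp only [one_mul, mul_one] at h3
    exact h3.1 (inV_vWord n)
  · intro h N _ hN g
    rw [lift_eq_ev, lift_eq_ev]
    exact (h.ev_eq (mem_E1_iff.1 hN) g hn).symm

/-! ### The identity uₙ₊₁ ≈ vₙ₊₁ on factors of `vWord n` -/

/-- The common prefix of `uWord k` and `vWord k`. -/
def hd : ℕ → List ℕ
  | 0 => []
  | k + 1 => cl k :: (k + 3) :: hd k

theorem toList_uWord (k : ℕ) : (uWord k).toList = hd k ++ [0, 0, 1, 1] := by
  induction k with
  | zero => rfl
  | succ k ih => rw [toList_uWord_succ, ih]; rfl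

theorem toList_vWord (k : ℕ) : (vWord k).toList = hd k ++ [1, 1, 0, 0] := by
  induction k with
  | zero => rfl
  | succ k ih => rw [toList_vWord_succ, ih]; rfl

theorem hd_succ_eq (k : ℕ) : ∃ H, hd (k + 1) = H ++ [0, 3] := by
  induction k with
  | zero => exact ⟨[], by simp [hd]⟩
  | succ k ih =>
    obtain ⟨H, hH⟩ := ih
    exact ⟨cl (k + 1) :: (k + 1 + 3) :: H, by rw [hd, hH]; rfl⟩

theorem pre_of_level {q : St} (h : 1 ≤ level q) : ∃ k f, q = .pre k f := by
  cases q with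
  | pre k f => exact ⟨k, f, rfl⟩
  | _ => simp [level] at h

/-- A factor without letters `t k` read before the last block is a power of a letter. -/
theorem eq_cl_of_run {q : St} {A : List ℕ} (hA : ∀ c ∈ A, c ≤ 1) (h : 1 ≤ level (run q A)) :
    ∃ k, level q = k + 1 ∧ level (run q A) = k + 1 ∧ ∀ c ∈ A, c = cl k := by
  induction A generalizing q with
  | nil =>
    obtain ⟨k, f, rfl⟩ := pre_of_level h
    exact ⟨k, rfl, rfl, by simp⟩
  | cons l A ih =>
    obtain ⟨k, h1, h2, h3⟩ := ih (fun c hc => hA c (List.mem_cons_of_mem _ hc)) h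
    have hq : 1 ≤ level q := by have := level_step_le q l; omega
    obtain ⟨j, f, rfl⟩ := pre_of_level hq
    have hl := hA l List.mem_cons_self
    by_cases h' : l = cl j
    · have : level (step (.pre j f) l) = j + 1 := by simp [step, h']
      obtain rfl : j = k := by omega
      exact ⟨j, rfl, h2, fun c hc => by
        rcases List.mem_cons.1 hc with rfl | hc
        · exact h'
        · exact h3 c hc⟩
    · have h4 : l ≠ j + 3 := by omega
      simp [step, h', h4, level] at h1

theorem level_pos_of_mem {q : St} {T S : List ℕ} (h : run q (T ++ S) = .ok) {l : ℕ} (hl : l ∈ T)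
    (h2 : 2 ≤ l) : 1 ≤ level q := by
  obtain ⟨T₁, T₂, rfl⟩ := List.append_of_mem hl
  rw [List.append_assoc, run_append, List.cons_append, run_cons] at h
  obtain ⟨k, hk, -⟩ := eq_of_step_ne_dead (q := run q T₁) h2
    (by intro h'; rw [h', run_dead] at h; cases h)
  have := level_run_le q T₁
  rw [hk, level_pre] at this
  omega

/-- A t-letter in the image of t₁ keeps all images of `a` and `b` before it at positive level, where
a factor over {a,b} is a power of one letter. Consecutive such images are not powers of the same
letter, so the level drops strictly between them. -/
theorem le_level_of_run {φ : ℕ → List ℕ} (h0 : ∀ c ∈ φ 0, c ≤ 1) (h1 : ∀ c ∈ φ 1, c ≤ 1)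
    {l : ℕ} (hl : l ∈ φ 3) (h2 : 2 ≤ l)
    (hne : ¬ ∃ c, (∀ x ∈ φ 0, x = c) ∧ ∀ x ∈ φ 1, x = c) (m : ℕ) {q : St} {S : List ℕ}
    (h : run q ((hd (m + 1)).flatMap φ ++ S) = .ok) :
    ∃ k, (∀ c ∈ φ (cl m), c = cl k) ∧ m ≤ k ∧ k + 1 ≤ level q := by
  have hcl : ∀ m, ∀ c ∈ φ (cl m), c ≤ 1 := fun m => by
    unfold cl; split
    · exact h0
    · exact h1
  induction m generalizing q with
  | zero =>
    simp only [hd, List.flatMap_cons, List.flatMap_nil, List.append_nil, List.append_assoc] at h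
    rw [run_append] at h
    obtain ⟨k, h3, -, h5⟩ := eq_cl_of_run (hcl 0) (level_pos_of_mem h hl h2)
    exact ⟨k, h5, Nat.zero_le _, h3.ge⟩
  | succ m ih =>
    rw [hd, List.flatMap_cons, List.flatMap_cons, List.append_assoc, List.append_assoc,
      run_append, run_append] at h
    obtain ⟨k, hk1, hk2, hk3⟩ := ih h
    have hle := level_run_le (run q (φ (cl (m + 1)))) (φ (m + 1 + 3))
    obtain ⟨k', h3, h4, h5⟩ := eq_cl_of_run (q := q) (hcl (m + 1)) (by omega)
    refine ⟨k', h5, ?_, h3.ge⟩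
    have : k' ≠ k := by
      rintro rfl
      apply hne
      refine ⟨cl k', ?_⟩
      by_cases he : Even m
      · have e1 : cl m = 0 := by simp [cl, he]
        have e2 : cl (m + 1) = 1 := by simp [cl, he, Nat.even_add_one]
        rw [e1] at hk1; rw [e2] at h5
        exact ⟨hk1, h5⟩
      · have e1 : cl m = 1 := by simp [cl, he]
        have e2 : cl (m + 1) = 0 := by simp [cl, he, Nat.even_add_one]
        rw [e1] at hk1; rw [e2] at h5
        exact ⟨h5, hk1⟩
    omega

/-- Substitution instances of the two sides of `uWord (n + 1) ≈ vWord (n + 1)` that divide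
`vWord n` modulo `β` are `β`-equivalent. -/
theorem IsE1.ev_sigma {N : Type u} [Monoid N] (hN : IsE1 N) (g : ℕ → N) {n : ℕ}
    {φ : ℕ → List ℕ} {P R S : List ℕ}
    (hR : R = φ 0 ++ φ 0 ++ φ 1 ++ φ 1 ∨ R = φ 1 ++ φ 1 ++ φ 0 ++ φ 0)
    (h : InV n (P ++ ((hd (n + 1)).flatMap φ ++ R) ++ S)) :
    ev g ((hd (n + 1)).flatMap φ ++ (φ 0 ++ φ 0 ++ φ 1 ++ φ 1))
      = ev g ((hd (n + 1)).flatMap φ ++ (φ 1 ++ φ 1 ++ φ 0 ++ φ 0)) := by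
  have h0 : ∀ c ∈ φ 0, c ≤ 1 := fun c hc => by
    refine le_one_of_run h.1 (l := c) ?_
    have := List.count_pos_iff.2 hc
    rcases hR with rfl | rfl <;> simp only [List.count_append] <;> omega
  have h1 : ∀ c ∈ φ 1, c ≤ 1 := fun c hc => by
    refine le_one_of_run h.1 (l := c) ?_
    have := List.count_pos_iff.2 hc
    rcases hR with rfl | rfl <;> simp only [List.count_append] <;> omega
  by_cases hne : ∃ c, (∀ x ∈ φ 0, x = c) ∧ ∀ x ∈ φ 1, x = c
  -- Powers of a common letter commute.
  · obtain ⟨c, hc0, hc1⟩ := hne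
    rw [List.eq_replicate_of_mem hc0, List.eq_replicate_of_mem hc1]
    simp only [List.replicate_append_replicate]
    congr 3
    omega
  -- If the image of t₁ has no t-letter, `φ 0 ++ φ 3` and the squares form one factor of multiple
  -- letters. Inserting φ(a)² after `φ 3` on one side, and at the end on the other, gives the same
  -- word.
  by_cases hT : ∀ l ∈ φ 3, l ≤ 1
  · obtain ⟨H, hH⟩ := hd_succ_eq n
    have hmem : ∀ c, c ≤ 1 → c ∈ φ 0 ∨ c ∈ φ 1 := by
      intro c hc
      by_contra hcon
      rw [not_or] at hcon
      apply hne
      refine ⟨1 - c, fun x hx => ?_, fun x hx => ?_⟩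
      · have := h0 x hx
        have : x ≠ c := by rintro rfl; exact hcon.1 hx
        omega
      · have := h1 x hx
        have : x ≠ c := by rintro rfl; exact hcon.2 hx
        omega
    have hle : ∀ c, c ∈ φ 0 ∨ c ∈ φ 3 ∨ c ∈ φ 1 → c ≤ 1 := by
      rintro c (hc | hc | hc)
      · exact h0 c hc
      · exact hT c hc
      · exact h1 c hc
    have e1 := hN.ev_absorb g (A := H.flatMap φ)
      (D := φ 0 ++ φ 3 ++ φ 0 ++ φ 0 ++ φ 1 ++ φ 1) (C := φ 0 ++ φ 0) (B := [])
      (by simp +contextual)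
      (fun d hd => by
        have : d ≤ 1 := hle d (by simp only [List.mem_append] at hd; tauto)
        rcases hmem d this with hd | hd <;>
        · have := List.count_pos_iff.2 hd
          simp only [List.count_append]; omega)
    have e2 := hN.ev_absorb g (A := H.flatMap φ)
      (D := φ 0 ++ φ 3) (C := φ 0 ++ φ 0) (B := φ 1 ++ φ 1 ++ φ 0 ++ φ 0)
      (by simp +contextual)
      (fun d hd => by
        have : d ≤ 1 := hle d (by simp only [List.mem_append] at hd; tauto)
        rcases hmem d this with hd | hd <;>
        · have := List.count_pos_iff.2 hd
          simp only [List.count_append]; omega)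
    rw [hH]
    simp only [List.flatMap_append, List.flatMap_cons, List.flatMap_nil, List.append_nil,
      ev_append, mul_assoc] at e1 e2 ⊢
    rw [← e1, e2]
  -- Otherwise n + 1 levels are needed, starting from level at most n.
  · push Not at hT
    obtain ⟨l, hl, h2⟩ := hT
    have := h.1
    rw [List.append_assoc, List.append_assoc, run_append] at this
    obtain ⟨k, -, h3, h4⟩ := le_level_of_run h0 h1 hl h2 hne n this
    have := level_run_le (start n) P
    rw [level_start] at this
    omega

/-- The identities of the monoids in `𝔼¹{σ_n}`. -/
structure IsE1Sigma (n : ℕ) (N : Type u) [Monoid N] : Prop extends IsE1 N where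
  sigma : ∀ g : ℕ → N, ev g (hd n ++ [0, 0, 1, 1]) = ev g (hd n ++ [1, 1, 0, 0])

theorem mem_E1sigma_iff {n : ℕ} {N : Type u} [Monoid N] :
    (E1sigma.{u} n).Mem N ↔ IsE1Sigma n N := by
  constructor
  · intro h
    refine ⟨mem_E1_iff.1 fun p hp => h p (Or.inl hp), fun g => ?_⟩
    have := h (uWord n, vWord n) (Or.inr rfl) g
    rwa [lift_eq_ev, lift_eq_ev, toList_uWord, toList_vWord] at this
  · rintro ⟨h1, h2⟩ p (hp | hp)
    · exact mem_E1_iff.2 h1 p hp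
    · obtain rfl : p = (uWord n, vWord n) := hp
      intro g
      rw [lift_eq_ev, lift_eq_ev, toList_uWord, toList_vWord]
      exact h2 g

/-! ### Invariants of words detected by the syntactic monoid -/

/-- The identities of the syntactic monoid of `InV n`. -/
def Rho (n : ℕ) (U V : List ℕ) : Prop :=
  ∀ (φ : ℕ → List ℕ) (P S : List ℕ),
    InV n (P ++ U.flatMap φ ++ S) ↔ InV n (P ++ V.flatMap φ ++ S)

theorem Rho.symm {n : ℕ} {U V : List ℕ} (h : Rho n U V) : Rho n V U :=
  fun φ P S => (h φ P S).symm

theorem flatMap_eq_replicate {φ : ℕ → List ℕ} {x c : ℕ} {w : List ℕ} (hx : φ x = [c])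
    (h : ∀ l ∈ w, l ≠ x → φ l = []) : w.flatMap φ = List.replicate (w.count x) c := by
  induction w with
  | nil => rfl
  | cons l w ih =>
    rw [List.flatMap_cons, ih fun e he => h e (List.mem_cons_of_mem _ he)]
    by_cases hl : l = x
    · subst hl; simp [hx, List.replicate_succ]
    · rw [h l List.mem_cons_self hl, List.count_cons_of_ne hl]; rfl

theorem not_mem_of_count_eq_one {s : ℕ} {A B : List ℕ} (h : (A ++ s :: B).count s = 1) :
    s ∉ A ∧ s ∉ B := by
  rw [List.count_append, List.count_cons_self] at h
  exact ⟨List.count_eq_zero.1 (by omega), List.count_eq_zero.1 (by omega)⟩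

/-- The common pattern of the tests below: one side is sent to such a word, the other to a word with
a wrong neighbour of t₁ or a wrong number of letters t₁. -/
theorem inV_intro {n i : ℕ} {L W : List ℕ} (hL : run (start n) L = start 1) (hi : 1 ≤ i)
    (hW : run .l0 W = .ok) (hc : 2 ≤ W.count 1) :
    InV n (L ++ List.replicate i 0 ++ 3 :: W) := by
  refine ⟨?_, ?_⟩
  · have h1 : run (.pre 0 false) (List.replicate i 0) = .pre 0 true := by
      simpa using run_replicate (k := 0) (f := false) hi
    have h2 : step (.pre 0 true) 3 = .l0 := step_t 0
    rw [run_append, run_append, hL, run_cons, start, h1, h2, hW]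
  · rw [List.count_append, List.count_cons]; omega

section Facts

variable {n : ℕ} (hn : 1 ≤ n) {U V : List ℕ} (h : Rho n U V)
include hn h

/-- Accepted words contain t₁ exactly once, so `x` is sent to t₁ and all else erased; the context
supplies t₁ in the first case and omits it in the second. -/
theorem Rho.count {x : ℕ} : (U.count x = 0 → V.count x = 0) ∧ (U.count x = 1 → V.count x = 1) := by
  obtain ⟨L, hL⟩ := exists_prefix hn
  have hU : ∀ w : List ℕ, w.flatMap (fun l => if l = x then [3] else [])
      = List.replicate (w.count x) 3 := fun w =>
    flatMap_eq_replicate (by simp) fun l _ hl => by simp [hl]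
  have base := inV_intro (i := 1) (W := [1, 1, 0]) hL le_rfl (by simp [step]) (by simp)
  have hb := base.count_three hn
  constructor
  · intro h0
    have := h (fun l => if l = x then [3] else []) (L ++ [0, 3, 1, 1, 0]) []
    rw [hU, hU, h0] at this
    have := (this.1 (by simpa using base)).count_three hn
    simp [List.count_append] at this hb
    omega
  · intro h1
    have := h (fun l => if l = x then [3] else []) (L ++ [0]) [1, 1, 0]
    rw [hU, hU, h1] at this
    have := (this.1 (by simpa using base)).count_three hn
    simp [List.count_append] at this hb
    omega

theorem Rho.two_le_count {x : ℕ} (hx : 2 ≤ V.count x) : 2 ≤ U.count x := by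
  by_contra hc
  have h1 := (h.count hn (x := x)).1
  have h2 := (h.count hn (x := x)).2
  omega

/-- The order of the simple letters is an invariant. -/
theorem Rho.order {s r : ℕ} {U₁ U₂ U₃ V₁ V₂ V₃ : List ℕ} (hU : U = U₁ ++ s :: U₂ ++ r :: U₃)
    (hV : V = V₁ ++ r :: V₂ ++ s :: V₃) (hs : U.count s = 1) (hr : U.count r = 1) : False := by
  obtain ⟨L, hL⟩ := exists_prefix hn
  have hs' := (h.count hn).2 hs
  have hr' := (h.count hn).2 hr
  subst hU hV
  have hsr : s ≠ r := by
    rintro rfl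
    simp only [List.count_append, List.count_cons_self] at hs; omega
  have hz : ∀ (w W : List ℕ), W.count s = 1 → W.count r = 1 → w.count s + 1 ≤ W.count s →
      w.count r + 1 ≤ W.count r →
      w.flatMap (fun l => if l = s then [0] else if l = r then [3] else []) = [] := by
    intro w W h1 h2 h3 h4
    rw [List.flatMap_eq_nil_iff]
    intro l hl
    have h5 : l ≠ s := by rintro rfl; have := List.count_pos_iff.2 hl; omega
    have h6 : l ≠ r := by rintro rfl; have := List.count_pos_iff.2 hl; omega
    simp [h5, h6]
  -- The images are a t₁ for `U` and t₁ a for `V`.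
  have := h (fun l => if l = s then [0] else if l = r then [3] else []) L [1, 1, 0]
  simp only [List.flatMap_append, List.flatMap_cons] at this
  rw [hz U₁ _ hs hr, hz U₂ _ hs hr, hz U₃ _ hs hr, hz V₁ _ hs' hr', hz V₂ _ hs' hr',
    hz V₃ _ hs' hr'] at this
  · have h2 := this.1 (by
      simpa [hsr.symm] using inV_intro (i := 1) (W := [1, 1, 0]) hL le_rfl (by simp [step]) (by simp))
    simp only [if_true, hsr.symm, if_false, List.nil_append, List.append_nil, List.append_assoc,
      List.cons_append] at h2
    obtain ⟨W, hW⟩ := h2.head_eq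
    simp at hW
  all_goals simp only [List.count_append, List.count_cons, beq_self_eq_true, if_true]; omega

/-- The letters after a simple letter are an invariant. -/
theorem Rho.mem_right {s x : ℕ} {U₁ U₂ V₁ V₂ : List ℕ} (hU : U = U₁ ++ s :: U₂)
    (hV : V = V₁ ++ s :: V₂) (hs : U.count s = 1) (hx : 2 ≤ U.count x) (hx2 : x ∈ V₂) :
    x ∈ U₂ := by
  obtain ⟨L, hL⟩ := exists_prefix hn
  have hs' := (h.count hn).2 hs
  subst hU hV
  by_contra hc
  have hsx : s ≠ x := by rintro rfl; omega
  obtain ⟨hs1, hs2⟩ := not_mem_of_count_eq_one hs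
  obtain ⟨hs3, hs4⟩ := not_mem_of_count_eq_one hs'
  have hz : ∀ w : List ℕ, s ∉ w →
      w.flatMap (fun l => if l = x then [0] else if l = s then [3] else [])
        = List.replicate (w.count x) 0 := fun w hw =>
    flatMap_eq_replicate (by simp) fun l hl hlx => by
      have : l ≠ s := by rintro rfl; exact hw hl
      simp [this, hlx]
  -- An `x` after `s` in `V` becomes an `a` directly after t₁, where `b` is required.
  have := h (fun l => if l = x then [0] else if l = s then [3] else []) L [1, 1, 0]
  simp only [List.flatMap_append, List.flatMap_cons] at this
  rw [hz _ hs1, hz _ hs2, hz _ hs3, hz _ hs4] at this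
  simp only [hsx, if_false, if_true, List.count_eq_zero_of_not_mem hc] at this
  have hx1 : 1 ≤ U₁.count x := by
    rw [List.count_append, List.count_cons_of_ne hsx, List.count_eq_zero_of_not_mem hc] at hx
    omega
  have h2 := this.1 (by
    simpa using inV_intro (W := [1, 1, 0]) hL hx1 (by simp [step]) (by simp))
  have h3 : InV n ((L ++ List.replicate (V₁.count x) 0) ++ 3 ::
      (List.replicate (V₂.count x) 0 ++ [1, 1, 0])) := by simpa using h2
  obtain ⟨W, hW⟩ := h3.head_eq
  obtain ⟨j, hj⟩ : ∃ j, V₂.count x = j + 1 :=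
    ⟨V₂.count x - 1, by have := List.count_pos_iff.2 hx2; omega⟩
  simp [hj, List.replicate_succ] at hW

/-- The letters before a simple letter are an invariant. -/
theorem Rho.mem_left {s x : ℕ} {U₁ U₂ V₁ V₂ : List ℕ} (hU : U = U₁ ++ s :: U₂)
    (hV : V = V₁ ++ s :: V₂) (hs : U.count s = 1) (hx : 2 ≤ U.count x) (hx2 : x ∈ V₁) :
    x ∈ U₁ := by
  obtain ⟨L, hL⟩ := exists_prefix hn
  have hs' := (h.count hn).2 hs
  subst hU hV
  by_contra hc
  have hsx : s ≠ x := by rintro rfl; omega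
  obtain ⟨hs1, hs2⟩ := not_mem_of_count_eq_one hs
  obtain ⟨hs3, hs4⟩ := not_mem_of_count_eq_one hs'
  have hz : ∀ w : List ℕ, s ∉ w →
      w.flatMap (fun l => if l = x then [1] else if l = s then [3] else [])
        = List.replicate (w.count x) 1 := fun w hw =>
    flatMap_eq_replicate (by simp) fun l hl hlx => by
      have : l ≠ s := by rintro rfl; exact hw hl
      simp [this, hlx]
  -- An `x` before `s` in `V` becomes a `b` directly before t₁, where `a` is required.
  have := h (fun l => if l = x then [1] else if l = s then [3] else []) (L ++ [0]) [0]
  simp only [List.flatMap_append, List.flatMap_cons] at this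
  rw [hz _ hs1, hz _ hs2, hz _ hs3, hz _ hs4] at this
  simp only [hsx, if_false, if_true, List.count_eq_zero_of_not_mem hc] at this
  have hx1 : 2 ≤ U₂.count x := by
    rw [List.count_append, List.count_cons_of_ne hsx, List.count_eq_zero_of_not_mem hc] at hx
    omega
  obtain ⟨i, hi⟩ : ∃ i, U₂.count x = i + 1 := ⟨U₂.count x - 1, by omega⟩
  have h2 := this.1 (by
    have := inV_intro (i := 1) (W := List.replicate (U₂.count x) 1 ++ [0]) hL le_rfl
      (by rw [hi, List.replicate_succ, List.cons_append]
          exact run_l0 (fun l hl => by simp at hl; omega) (by simp)) (by simpa using hx1)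
    simpa using this)
  have h3 : InV n ((L ++ [0] ++ List.replicate (V₁.count x) 1) ++ 3 ::
      (List.replicate (V₂.count x) 1 ++ [0])) := by simpa using h2
  obtain ⟨A, hA⟩ := h3.last_eq
  obtain ⟨j, hj⟩ : ∃ j, V₁.count x = j + 1 :=
    ⟨V₁.count x - 1, by have := List.count_pos_iff.2 hx2; omega⟩
  have := congrArg List.getLast? hA
  rw [hj, List.replicate_succ', ← List.append_assoc, List.getLast?_append_of_ne_nil _ (by simp),
    List.getLast?_append_of_ne_nil _ (by simp)] at this
  simp at this

/-- The letters between two simple letters are an invariant. -/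
theorem Rho.mem_mid {s r x : ℕ} {U₁ U₂ U₃ V₁ V₂ V₃ : List ℕ} (hU : U = U₁ ++ s :: U₂ ++ r :: U₃)
    (hV : V = V₁ ++ s :: V₂ ++ r :: V₃) (hs : U.count s = 1) (hr : U.count r = 1)
    (hx : 2 ≤ U.count x) (hx2 : x ∈ V₂) : x ∈ U₂ := by
  obtain ⟨L, hL⟩ := exists_prefix hn
  have hs' := (h.count hn).2 hs
  have hr' := (h.count hn).2 hr
  subst hU hV
  by_contra hc
  have hsr : s ≠ r := by
    rintro rfl
    simp only [List.count_append, List.count_cons_self] at hs; omega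
  have hsx : s ≠ x := by rintro rfl; omega
  have hrx : r ≠ x := by rintro rfl; omega
  have hz : ∀ (w W : List ℕ), W.count s = 1 → W.count r = 1 → w.count s + 1 ≤ W.count s →
      w.count r + 1 ≤ W.count r →
      w.flatMap (fun l => if l = x then [0] else if l = s then [3] else if l = r then [1, 1] else [])
        = List.replicate (w.count x) 0 := by
    intro w W h1 h2 h3 h4
    refine flatMap_eq_replicate (by simp) fun l hl hlx => ?_
    have h5 : l ≠ s := by rintro rfl; have := List.count_pos_iff.2 hl; omega
    have h6 : l ≠ r := by rintro rfl; have := List.count_pos_iff.2 hl; omega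
    simp [h5, h6, hlx]
  -- An `x` between `s` and `r` in `V` becomes an `a` between t₁ and b².
  have := h (fun l => if l = x then [0] else if l = s then [3] else if l = r then [1, 1] else [])
    (L ++ [0]) [0]
  simp only [List.flatMap_append, List.flatMap_cons] at this
  rw [hz U₁ _ hs hr, hz U₂ _ hs hr, hz U₃ _ hs hr, hz V₁ _ hs' hr', hz V₂ _ hs' hr',
    hz V₃ _ hs' hr'] at this
  · simp only [hsx, hrx, hsr.symm, if_false, if_true, List.count_eq_zero_of_not_mem hc] at this
    have h2 := this.1 (by
      have := inV_intro (i := U₁.count x + 1)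
        (W := [1, 1] ++ List.replicate (U₃.count x) 0 ++ [0]) hL (by omega)
        (run_l0 (fun l hl => by simp at hl; omega) (by simp)) (by simp)
      simpa [List.replicate_succ] using this)
    have h3 : InV n ((L ++ [0] ++ List.replicate (V₁.count x) 0) ++ 3 ::
        (List.replicate (V₂.count x) 0 ++ [1, 1] ++ List.replicate (V₃.count x) 0 ++ [0])) := by
      simpa using h2
    obtain ⟨W, hW⟩ := h3.head_eq
    obtain ⟨j, hj⟩ : ∃ j, V₂.count x = j + 1 :=
      ⟨V₂.count x - 1, by have := List.count_pos_iff.2 hx2; omega⟩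
    simp [hj, List.replicate_succ] at hW
  all_goals simp only [List.count_append, List.count_cons, beq_self_eq_true, if_true]; omega

end Facts

/-! ### Comparing the next letter after a common prefix -/

theorem forall_or_last_split (K : ℕ → Prop) (p : List ℕ) :
    (∀ l ∈ p, K l) ∨ ∃ p₁ s p₂, p = p₁ ++ s :: p₂ ∧ ¬ K s ∧ ∀ l ∈ p₂, K l := by
  induction p with
  | nil => simp
  | cons l p ih =>
    rcases ih with h | ⟨p₁, s, p₂, rfl, h1, h2⟩
    · by_cases hl : K l
      · left; simpa [hl] using h
      · exact Or.inr ⟨[], l, p, rfl, hl, h⟩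
    · exact Or.inr ⟨l :: p₁, s, p₂, rfl, h1, h2⟩

theorem forall_or_first_split (K : ℕ → Prop) (p : List ℕ) :
    (∀ l ∈ p, K l) ∨ ∃ p₁ s p₂, p = p₁ ++ s :: p₂ ∧ ¬ K s ∧ ∀ l ∈ p₁, K l := by
  induction p with
  | nil => simp
  | cons l p ih =>
    by_cases hl : K l
    · rcases ih with h | ⟨p₁, s, p₂, rfl, h1, h2⟩
      · left; simpa [hl] using h
      · exact Or.inr ⟨l :: p₁, s, p₂, rfl, h1, by simpa [hl] using h2⟩
    · exact Or.inr ⟨[], l, p, rfl, hl, by simp⟩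

/-- The letter `x` occurs in `p` after the last letter not in `K`. -/
def InBlock (K : ℕ → Prop) (x : ℕ) (p : List ℕ) : Prop :=
  ∃ p₁ p₂, p = p₁ ++ x :: p₂ ∧ ∀ l ∈ p₂, K l

theorem inBlock_of_mem {K : ℕ → Prop} {x : ℕ} {p₁ p₂ : List ℕ} (hx : x ∈ p₂)
    (h : ∀ l ∈ p₂, K l) : InBlock K x (p₁ ++ p₂) := by
  obtain ⟨A, B, rfl⟩ := List.append_of_mem hx
  exact ⟨p₁ ++ A, B, by simp, fun l hl => h l (by simp [hl])⟩

theorem count_eq_one_of {K : ℕ → Prop} {U : List ℕ} (hK : ∀ l, K l ↔ 2 ≤ U.count l) {s : ℕ}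
    (hs : ¬ K s) (hm : s ∈ U) : U.count s = 1 := by
  rw [hK] at hs
  have := List.count_pos_iff.2 hm
  omega

section Steps

variable {n : ℕ} (hn : 1 ≤ n) {p u v : List ℕ} {x : ℕ} (h : Rho n (p ++ u) (p ++ x :: v))
  {K : ℕ → Prop} (hK : ∀ l, K l ↔ 2 ≤ (p ++ u).count l)
include hn h hK

/-- Let `s` be the last simple letter of `p` and `r` the first one of `u`. In `V` the displayed `x`
stands between them, so some `x` does so in `U`; when `s` or `r` is missing, the one-sided
invariants take over. -/
theorem Rho.inBlock_or (hx : K x) :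
    InBlock K x p ∨ ∃ w u', u = w ++ x :: u' ∧ (∀ l ∈ w, K l) ∧ x ∉ w := by
  by_contra! hcon
  obtain ⟨hp, hu⟩ := hcon
  have hx2 := (hK x).1 hx
  have hu' : ∀ w u', u = w ++ u' → (∀ l ∈ w, K l) → x ∉ w := by
    rintro w u' rfl hw hxw
    obtain ⟨A, B, rfl, hA⟩ := List.eq_append_cons_of_mem hxw
    exact hA (hu A (B ++ u') (by simp) fun l hl => hw l (by simp [hl]))
  -- a simple letter of `u` occurs in `v`
  have hsplit : ∀ w r u', u = w ++ r :: u' → ¬ K r → ∃ v₁ v₂, v = v₁ ++ r :: v₂ := by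
    rintro w r u' rfl hr
    have h1 : (p ++ (w ++ r :: u')).count r = 1 := count_eq_one_of hK hr (by simp)
    have h2 := (h.count hn).2 h1
    have hrx : x ≠ r := by rintro rfl; exact hr hx
    rw [List.count_append, List.count_cons_of_ne hrx] at h2
    rw [List.count_append, List.count_append, List.count_cons_self] at h1
    exact List.append_of_mem (List.count_pos_iff.1 (by omega))
  rcases forall_or_last_split K p with hpK | ⟨p₁, s, p₂, hp12, hs, hp2⟩ <;>
    rcases forall_or_first_split K u with huK | ⟨w, r, u', hwu, hr, hw⟩
  · have : x ∈ p ++ u := List.count_pos_iff.1 (by omega)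
    rcases List.mem_append.1 this with hm | hm
    · exact hp (by simpa using inBlock_of_mem (p₁ := []) hm hpK)
    · exact hu' u [] (by simp) huK hm
  · obtain ⟨v₁, v₂, rfl⟩ := hsplit w r u' hwu hr
    have := h.mem_left hn (s := r) (x := x) (U₁ := p ++ w) (U₂ := u') (V₁ := p ++ x :: v₁)
      (V₂ := v₂) (by simp [hwu]) (by simp) (count_eq_one_of hK hr (by simp [hwu])) hx2 (by simp)
    rcases List.mem_append.1 this with hm | hm
    · exact hp (by simpa using inBlock_of_mem (p₁ := []) hm hpK)
    · exact hu' w _ hwu hw hm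
  · have := h.mem_right hn (s := s) (x := x) (U₁ := p₁) (U₂ := p₂ ++ u) (V₁ := p₁)
      (V₂ := p₂ ++ x :: v) (by simp [hp12]) (by simp [hp12])
      (count_eq_one_of hK hs (by simp [hp12])) hx2 (by simp)
    rcases List.mem_append.1 this with hm | hm
    · exact hp (by simpa [hp12] using inBlock_of_mem (p₁ := p₁ ++ [s]) hm hp2)
    · exact hu' u [] (by simp) huK hm
  · obtain ⟨v₁, v₂, rfl⟩ := hsplit w r u' hwu hr
    have := h.mem_mid hn (s := s) (r := r) (x := x) (U₁ := p₁) (U₂ := p₂ ++ w) (U₃ := u')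
      (V₁ := p₁) (V₂ := p₂ ++ x :: v₁) (V₃ := v₂) (by simp [hp12, hwu]) (by simp [hp12])
      (count_eq_one_of hK hs (by simp [hp12])) (count_eq_one_of hK hr (by simp [hwu])) hx2
      (by simp)
    rcases List.mem_append.1 this with hm | hm
    · exact hp (by simpa [hp12] using inBlock_of_mem (p₁ := p₁ ++ [s]) hm hp2)
    · exact hu' w _ hwu hw hm

/-- If the next letter on one side is simple then, on the other side, only letters already met in
the current block precede it. -/
theorem Rho.simple_split (hx : ¬ K x) :
    ∃ w u', u = w ++ x :: u' ∧ ∀ y ∈ w, K y ∧ InBlock K y p := by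
  have hxV : (p ++ x :: v).count x = 1 := by
    have h1 : ¬ 2 ≤ (p ++ x :: v).count x := fun h' => hx ((hK x).2 (h.two_le_count hn h'))
    have h2 : 1 ≤ (p ++ x :: v).count x := List.count_pos_iff.2 (by simp)
    omega
  have hxU := (h.symm.count hn).2 hxV
  have hxp := (not_mem_of_count_eq_one hxV).1
  have hxu : x ∈ u := by
    have : x ∈ p ++ u := List.count_pos_iff.1 (by omega)
    simpa [hxp] using this
  obtain ⟨w, u', rfl⟩ := List.append_of_mem hxu
  refine ⟨w, u', rfl, ?_⟩
  have hw : ∀ y ∈ w, K y := by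
    intro y hy
    by_contra hyK
    obtain ⟨w₁, w₂, rfl⟩ := List.append_of_mem hy
    have hy1 := count_eq_one_of hK hyK (by simp)
    have hyx : x ≠ y := by
      rintro rfl
      rw [← List.append_assoc] at hxU
      exact (not_mem_of_count_eq_one hxU).1 (by simp)
    have hy2 := (h.count hn).2 hy1
    have hyv : y ∈ v := by
      rw [List.count_append, List.count_cons_of_ne hyx] at hy2
      simp only [List.count_append, List.count_cons_self] at hy1
      exact List.count_pos_iff.1 (by omega)
    obtain ⟨v₁, v₂, rfl⟩ := List.append_of_mem hyv
    exact h.order hn (s := y) (r := x) (U₁ := p ++ w₁) (U₂ := w₂) (U₃ := u') (V₁ := p)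
      (V₂ := v₁) (V₃ := v₂) (by simp) (by simp) hy1 hxU
  intro y hy
  have hyV : 2 ≤ (p ++ x :: v).count y := h.symm.two_le_count hn ((hK y).1 (hw y hy))
  refine ⟨hw y hy, ?_⟩
  rcases forall_or_last_split K p with hpK | ⟨p₁, s, p₂, rfl, hs, hp2⟩
  · have := h.symm.mem_left hn (s := x) (x := y) (U₁ := p) (U₂ := v) (V₁ := p ++ w)
      (V₂ := u') rfl (by simp) hxV hyV
      (by simp [hy])
    simpa using inBlock_of_mem (p₁ := []) this hpK
  · have hs1 := (h.count hn).2 (count_eq_one_of hK hs (by simp))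
    have := h.symm.mem_mid hn (s := s) (r := x) (x := y) (U₁ := p₁) (U₂ := p₂) (V₁ := p₁)
      (V₂ := p₂ ++ w) (U₃ := v) (V₃ := u') (by simp) (by simp) hs1 hxV hyV (by simp [hy])
    simpa using inBlock_of_mem (p₁ := p₁ ++ [s]) this hp2

end Steps

/-! ### At most n runs: the order of first occurrences is detected -/

/-- `Runs K d z z' P`: the occurrences of `z`, `z'` in `P` form `d` maximal runs of equal letters,
the last one consisting of `z`, and consecutive runs are separated by letters not in `K`. -/
inductive Runs (K : ℕ → Prop) : ℕ → ℕ → ℕ → List ℕ → Prop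
  | base (z z' : ℕ) (P : List ℕ) : z ∈ P → z' ∉ P → Runs K 1 z z' P
  | step (d z z' : ℕ) (P : List ℕ) (s : ℕ) (Q : List ℕ) :
      Runs K d z z' P → ¬ K s → z ∉ Q → z' ∈ Q → Runs K (d + 1) z' z (P ++ s :: Q)

theorem Runs.concat {K : ℕ → Prop} {d z z' : ℕ} {P : List ℕ} (h : Runs K d z z' P) {l : ℕ}
    (hl : l ≠ z') : Runs K d z z' (P ++ [l]) := by
  cases h with
  | base _ _ _ h1 h2 => exact .base _ _ _ (by simp [h1]) (by simp [h2, hl.symm])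
  | step d z z' P s Q h1 h2 h3 h4 =>
    rw [List.append_assoc]
    exact .step _ _ _ _ _ _ h1 h2 (by simp [h3, hl.symm]) (by simp [h4])

/-- Some block of `P` contains both `x` and `y`. -/
def Both (K : ℕ → Prop) (x y : ℕ) (P : List ℕ) : Prop :=
  ∃ P₁ z M z' Q, P = P₁ ++ z :: M ++ z' :: Q ∧ ((z = x ∧ z' = y) ∨ (z = y ∧ z' = x)) ∧
    ∀ l ∈ M, K l

theorem Both.append {K : ℕ → Prop} {x y : ℕ} {P : List ℕ} (h : Both K x y P) (R : List ℕ) :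
    Both K x y (P ++ R) := by
  obtain ⟨P₁, z, M, z', Q, rfl, h1, h2⟩ := h
  exact ⟨P₁, z, M, z', Q ++ R, by simp, h1, h2⟩

theorem InBlock.concat {K : ℕ → Prop} {x l : ℕ} {P : List ℕ} (h : InBlock K x P) (hl : K l) :
    InBlock K x (P ++ [l]) := by
  obtain ⟨P₁, P₂, rfl, h⟩ := h
  refine ⟨P₁, P₂ ++ [l], by simp, fun m hm => ?_⟩
  rcases List.mem_append.1 hm with hm | hm
  · exact h m hm
  · rwa [List.mem_singleton.1 hm]

theorem inBlock_concat_self (K : ℕ → Prop) (x : ℕ) (P : List ℕ) : InBlock K x (P ++ [x]) :=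
  ⟨P, [], rfl, by simp⟩

/-- Letters are appended one at a time: a new `z'` either shares the block of the last `z`, giving
`Both`, or comes after a simple letter and opens a new run. -/
theorem runs_trichotomy {K : ℕ → Prop} {x y : ℕ} (hxy : x ≠ y) (hx : K x) (hy : K y)
    (P : List ℕ) : (x ∉ P ∧ y ∉ P) ∨ Both K x y P ∨
      ∃ d z z', ((z = x ∧ z' = y) ∨ (z = y ∧ z' = x)) ∧ Runs K d z z' P ∧
        (InBlock K z P ∨ ∃ P₀ s Q, P = P₀ ++ s :: Q ∧ ¬ K s ∧ Runs K d z z' P₀ ∧ x ∉ Q ∧ y ∉ Q) := by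
  induction P using List.reverseRecOn with
  | nil => simp
  | append_singleton P l ih =>
    rcases ih with ⟨h1, h2⟩ | h | ⟨d, z, z', hz, hR, hP⟩
    · by_cases hlx : l = x
      · subst hlx
        exact Or.inr (Or.inr ⟨1, l, y, Or.inl ⟨rfl, rfl⟩, .base _ _ _ (by simp)
          (by simp [h2, hxy.symm]), Or.inl (inBlock_concat_self _ _ _)⟩)
      by_cases hly : l = y
      · subst hly
        exact Or.inr (Or.inr ⟨1, l, x, Or.inr ⟨rfl, rfl⟩, .base _ _ _ (by simp)
          (by simp [h1, hxy]), Or.inl (inBlock_concat_self _ _ _)⟩)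
      left
      simp [h1, h2, Ne.symm hlx, Ne.symm hly]
    · exact Or.inr (Or.inl (h.append [l]))
    · by_cases hlz' : l = z'
      · subst hlz'
        rcases hP with ⟨P₁, M, rfl, hM⟩ | ⟨P₀, s, Q, rfl, hs, hR0, hQx, hQy⟩
        · exact Or.inr (Or.inl ⟨P₁, z, M, l, [], rfl, hz, hM⟩)
        · refine Or.inr (Or.inr ⟨d + 1, l, z, ?_, ?_, Or.inl (inBlock_concat_self _ _ _)⟩)
          · rcases hz with ⟨rfl, rfl⟩ | ⟨rfl, rfl⟩ <;> simp
          · rw [List.append_assoc]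
            refine .step _ _ _ _ _ _ hR0 hs ?_ (by simp)
            rcases hz with ⟨rfl, rfl⟩ | ⟨rfl, rfl⟩ <;> simp [hQx, hQy, hxy, hxy.symm]
      · have hR' := hR.concat hlz'
        refine Or.inr (Or.inr ⟨d, z, z', hz, hR', ?_⟩)
        by_cases hlz : l = z
        · subst hlz; exact Or.inl (inBlock_concat_self _ _ _)
        have hlx : x ≠ l := by rcases hz with ⟨rfl, rfl⟩ | ⟨rfl, rfl⟩ <;> tauto
        have hly : y ≠ l := by rcases hz with ⟨rfl, rfl⟩ | ⟨rfl, rfl⟩ <;> tauto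
        rcases hP with hP | ⟨P₀, s, Q, rfl, hs, hR0, hQx, hQy⟩
        · by_cases hl : K l
          · exact Or.inl (hP.concat hl)
          · exact Or.inr ⟨P, l, [], rfl, hl, hR, by simp, by simp⟩
        · exact Or.inr ⟨P₀, s, Q ++ [l], by simp, hs, hR0, by simp [hQx, hlx], by simp [hQy, hly]⟩

theorem flatMap_congr_of_mem {φ ψ : ℕ → List ℕ} {w : List ℕ} (h : ∀ l ∈ w, φ l = ψ l) :
    w.flatMap φ = w.flatMap ψ := by
  induction w with
  | nil => rfl
  | cons l w ih =>
    rw [List.flatMap_cons, List.flatMap_cons, h l List.mem_cons_self,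
      ih fun e he => h e (List.mem_cons_of_mem _ he)]

/-- A word with `d` runs can be mapped onto a segment of the prefix of `vWord n`. -/
theorem Runs.exists_subst {K : ℕ → Prop} {n d z z' : ℕ} {P : List ℕ} (h : Runs K d z z' P)
    (hz : K z) (hz' : K z') (hzz : z ≠ z') (hP : ∀ l, ¬ K l → P.count l ≤ 1) {e : ℕ}
    (he : e + d ≤ n) :
    ∃ (L : List ℕ) (φ : ℕ → List ℕ), φ z = [cl e] ∧ φ z' = [cl (e + 1)] ∧
      (∀ l, l ≠ z → l ≠ z' → (l ∉ P ∨ K l) → φ l = []) ∧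
      run (start n) (L ++ P.flatMap φ) = .pre e true := by
  induction h generalizing e with
  | base z z' P h1 h2 =>
    obtain ⟨L, hL⟩ := exists_prefix he
    refine ⟨L, fun l => if l = z then [cl e] else if l = z' then [cl (e + 1)] else [], by simp,
      by simp [hzz.symm], fun l h3 h4 _ => by simp [h3, h4], ?_⟩
    rw [run_append, hL, flatMap_eq_replicate (x := z) (c := cl e) (by simp)
      (fun l hl hlz => by
        have : l ≠ z' := by rintro rfl; exact h2 hl
        simp [hlz, this])]
    exact run_replicate (List.count_pos_iff.2 h1)
  | step d z z' P s Q h1 hs hzQ hz'Q ih =>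
    have hsz : s ≠ z := by rintro rfl; exact hs hz'
    have hsz' : s ≠ z' := by rintro rfl; exact hs hz
    have hP' : ∀ l, ¬ K l → P.count l + (s :: Q).count l ≤ 1 := fun l hl => by
      have := hP l hl
      rwa [List.count_append] at this
    -- The shorter word is placed one level higher with the two letters exchanged; `cl (e + 2) = cl
    -- e` makes their images agree with those needed here.
    obtain ⟨L, φ, hφz, hφz', hφ, hrun⟩ := ih hz' hz hzz.symm
      (fun l hl => by have := hP' l hl; omega) (e := e + 1) (by omega)
    have hsP : s ∉ P := by
      have := hP' s hs
      rw [List.count_cons_self] at this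
      exact List.count_eq_zero.1 (by omega)
    have hsQ : s ∉ Q := by
      have := hP' s hs
      rw [List.count_cons_self] at this
      exact List.count_eq_zero.1 (by omega)
    -- The separator `s` is sent to (e + 1) + 3, the t-letter that closes level e + 1 of the
    -- automaton.
    have hup : ∀ l, l ≠ s → Function.update φ s [e + 4] l = φ l := fun l hl =>
      Function.update_of_ne hl _ _
    refine ⟨L, Function.update φ s [e + 4], ?_, ?_, ?_, ?_⟩
    · rw [hup _ hsz'.symm, hφz', cl_add_two]
    · rw [hup _ hsz.symm, hφz]
    · intro l hl1 hl2 hl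
      have hls : l ≠ s := by
        rintro rfl
        rcases hl with hl | hl
        · simp at hl
        · exact hs hl
      rw [hup _ hls]
      refine hφ l hl2 hl1 ?_
      rcases hl with hl | hl
      · left; intro hl'; exact hl (by simp [hl'])
      · exact Or.inr hl
    · have e1 : P.flatMap (Function.update φ s [e + 4]) = P.flatMap φ :=
        flatMap_congr_of_mem fun l hl => hup l (by rintro rfl; exact hsP hl)
      have e2 : Q.flatMap (Function.update φ s [e + 4]) = List.replicate (Q.count z') (cl e) := by
        refine flatMap_eq_replicate (by rw [hup _ hsz'.symm, hφz', cl_add_two]) ?_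
        intro l hl hlz'
        have hls : l ≠ s := by rintro rfl; exact hsQ hl
        have hlz : l ≠ z := by rintro rfl; exact hzQ hl
        rw [hup _ hls]
        refine hφ l hlz hlz' ?_
        by_cases hlK : K l
        · exact Or.inr hlK
        · left
          have h3 := hP' l hlK
          have h4 : 1 ≤ (s :: Q).count l := List.count_pos_iff.2 (by simp [hl])
          exact List.count_eq_zero.1 (by omega)
      rw [List.flatMap_append, List.flatMap_cons, e1, e2, Function.update_self, ← List.append_assoc,
        run_append, hrun, run_append, run_cons, run_nil, show e + 4 = e + 1 + 3 by ring, step_t]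
      exact run_replicate (List.count_pos_iff.2 hz'Q)

theorem count_le_count_flatMap {φ : ℕ → List ℕ} {x c : ℕ} (hx : φ x = [c]) (w : List ℕ) :
    w.count x ≤ (w.flatMap φ).count c := by
  induction w with
  | nil => simp
  | cons l w ih =>
    rw [List.flatMap_cons, List.count_append, List.count_cons]
    by_cases hl : l = x
    · subst hl; simp [hx]; omega
    · simp [hl]; omega

theorem flatMap_split {φ : ℕ → List ℕ} {A₁ A₂ : List ℕ} {z c : ℕ} (hz : φ z = [c])
    (h : ∀ l ∈ A₁, φ l = []) : (A₁ ++ z :: A₂).flatMap φ = c :: A₂.flatMap φ := by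
  rw [List.flatMap_append, List.flatMap_cons, hz, List.flatMap_eq_nil_iff.2 h]; rfl

theorem flatMap_le_one {φ : ℕ → List ℕ} {A : List ℕ}
    (h : ∀ l ∈ A, φ l = [0] ∨ φ l = [1] ∨ φ l = []) : ∀ c ∈ A.flatMap φ, c ≤ 1 := by
  intro c hc
  obtain ⟨l, hl, hc⟩ := List.mem_flatMap.1 hc
  rcases h l hl with h | h | h <;> rw [h] at hc <;> simp at hc <;> omega

/-- Letters whose earlier occurrences form at most `n` runs keep their order. -/
theorem Rho.runs_false {n : ℕ} (hn : 1 ≤ n) {P₀ Q A₁ A₂ B₁ B₂ : List ℕ} {s z z' d : ℕ}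
    (h : Rho n (P₀ ++ s :: Q ++ (A₁ ++ z' :: A₂)) (P₀ ++ s :: Q ++ (B₁ ++ z :: B₂)))
    {K : ℕ → Prop} (hK : ∀ l, K l ↔ 2 ≤ (P₀ ++ s :: Q ++ (A₁ ++ z' :: A₂)).count l)
    (hs : ¬ K s) (hR : Runs K d z z' P₀) (hd : d ≤ n) (hz : K z) (hz' : K z') (hzz : z ≠ z')
    (hQ : z ∉ Q ∧ z' ∉ Q) (hA : z ∉ A₁ ∧ z' ∉ A₁) (hB : z ∉ B₁ ∧ z' ∉ B₁) (hzA : z ∈ A₂) :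
    False := by
  have hKU : ∀ l, ¬ K l → (P₀ ++ s :: Q ++ (A₁ ++ z' :: A₂)).count l ≤ 1 := fun l hl => by
    rw [hK] at hl; omega
  have hKV : ∀ l, ¬ K l → (P₀ ++ s :: Q ++ (B₁ ++ z :: B₂)).count l ≤ 1 := fun l hl => by
    by_contra hc
    exact hl ((hK l).2 (h.two_le_count hn (by omega)))
  -- With e = 0 the image of `P₀` ends just before t₁, with `z` sent to `a` and `z'` to `b`. Sending
  -- `s` to t₁ then leaves the first word with `b` after t₁ and the second with `a`.
  obtain ⟨L, φ, hφz, hφz', hφ, hrun⟩ := hR.exists_subst (n := n) hz hz' hzz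
    (fun l hl => by have := hKU l hl; simp only [List.count_append] at this; omega) (e := 0)
    (by omega)
  have hup : ∀ l, l ≠ s → Function.update φ s [3] l = φ l := fun l hl =>
    Function.update_of_ne hl _ _
  have hsz : s ≠ z := by rintro rfl; exact hs hz
  have hsz' : s ≠ z' := by rintro rfl; exact hs hz'
  -- letters after `P₀ s`
  have hnil : ∀ T : List ℕ, (∀ l, ¬ K l → (P₀ ++ s :: T).count l ≤ 1) → ∀ l ∈ T, l ≠ z → l ≠ z' →
      Function.update φ s [3] l = [] := by
    intro T hT l hl h1 h2
    have hls : l ≠ s := by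
      rintro rfl
      have h3 := hT l hs
      have h4 := List.count_pos_iff.2 hl
      rw [List.count_append, List.count_cons_self] at h3
      omega
    rw [hup l hls]
    refine hφ l h1 h2 ?_
    by_cases hlK : K l
    · exact Or.inr hlK
    · left
      have h3 := hT l hlK
      have h4 := List.count_pos_iff.2 hl
      rw [List.count_append, List.count_cons] at h3
      exact List.count_eq_zero.1 (by omega)
  have hψz : Function.update φ s [3] z = [0] := by rw [hup z hsz.symm, hφz, cl_zero]
  have hψz' : Function.update φ s [3] z' = [1] := by rw [hup z' hsz'.symm, hφz']; rfl
  have hnilU := hnil (Q ++ (A₁ ++ z' :: A₂)) (by simpa using hKU)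
  have hnilV := hnil (Q ++ (B₁ ++ z :: B₂)) (by simpa using hKV)
  have hP0 : P₀.flatMap (Function.update φ s [3]) = P₀.flatMap φ :=
    flatMap_congr_of_mem fun l hl => hup l (by
      rintro rfl
      have := hKU l hs
      have h4 := List.count_pos_iff.2 hl
      simp only [List.count_append, List.count_cons_self] at this
      omega)
  have hQ0 : Q.flatMap (Function.update φ s [3]) = [] :=
    List.flatMap_eq_nil_iff.2 fun l hl => hnilU l (by simp [hl])
      (by rintro rfl; exact hQ.1 hl) (by rintro rfl; exact hQ.2 hl)
  have hA0 := flatMap_split (A₁ := A₁) (A₂ := A₂) hψz' fun l hl => hnilU l (by simp [hl])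
      (by rintro rfl; exact hA.1 hl) (by rintro rfl; exact hA.2 hl)
  have hB0 := flatMap_split (A₁ := B₁) (A₂ := B₂) hψz fun l hl => hnilV l (by simp [hl])
      (by rintro rfl; exact hB.1 hl) (by rintro rfl; exact hB.2 hl)
  have key := h (Function.update φ s [3]) L []
  have hcount : 2 ≤ ((P₀ ++ s :: Q ++ (A₁ ++ z' :: A₂)).flatMap (Function.update φ s [3])).count 1 :=
    ((hK z').1 hz').trans (count_le_count_flatMap hψz' _)
  rw [List.flatMap_append, List.flatMap_append, List.flatMap_cons, hP0, hQ0, hA0,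
    Function.update_self] at key hcount
  rw [List.flatMap_append, List.flatMap_append, List.flatMap_cons, hP0, hQ0, hB0,
    Function.update_self] at key
  have hU : InV n (L ++ (P₀.flatMap φ ++ ([3] ++ []) ++
      1 :: A₂.flatMap (Function.update φ s [3])) ++ []) := by
    refine ⟨?_, by simp only [List.count_append] at hcount ⊢; omega⟩
    have h2 : run (.pre 0 true) [3] = .l0 := step_t 0
    have h3 : run .l0 (1 :: A₂.flatMap (Function.update φ s [3])) = .ok := by
      refine run_l0 (flatMap_le_one fun l hl => ?_) (List.mem_flatMap.2 ⟨z, hzA, by simp [hψz]⟩)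
      by_cases h3 : l = z
      · left; rw [h3, hψz]
      · by_cases h4 : l = z'
        · right; left; rw [h4, hψz']
        · right; right; exact hnilU l (by simp [hl]) h3 h4
    rw [List.append_nil, ← List.append_assoc, ← List.append_assoc, run_append, run_append, hrun,
      List.append_nil, h2, h3]
  have hV := key.1 hU
  have hV' : InV n ((L ++ P₀.flatMap φ) ++ 3 :: 0 :: B₂.flatMap (Function.update φ s [3])) := by
    simpa using hV
  obtain ⟨W, hW⟩ := hV'.head_eq
  simp at hW

/-- Letters without earlier occurrences keep their order. -/
theorem Rho.fresh_false {n : ℕ} {A₁ A₂ B₁ B₂ : List ℕ} {x y : ℕ} (hxy : x ≠ y)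
    (h : Rho n (A₁ ++ y :: A₂) (B₁ ++ x :: B₂)) (hA : x ∉ A₁ ∧ y ∉ A₁) (hB : x ∉ B₁ ∧ y ∉ B₁)
    (hx : x ∈ A₂) (hy : 2 ≤ (A₁ ++ y :: A₂).count y) : False := by
  -- After the full prefix `L` the automaton demands `b` first, so sending `y` to `b` and `x` to `a`
  -- tests which comes first.
  obtain ⟨L, hL⟩ := exists_prefix (Nat.zero_le n)
  set φ : ℕ → List ℕ := fun l => if l = y then [1] else if l = x then [0] else [] with hφ
  have hφy : φ y = [1] := by simp [hφ]
  have hφx : φ x = [0] := by simp [hφ, hxy]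
  have hnil : ∀ l, l ≠ x → l ≠ y → φ l = [] := fun l h1 h2 => by simp [hφ, h1, h2]
  have key := h φ L []
  have hcount := hy.trans (count_le_count_flatMap hφy _)
  rw [flatMap_split hφy fun l hl => hnil l (by rintro rfl; exact hA.1 hl)
    (by rintro rfl; exact hA.2 hl)] at key hcount
  rw [flatMap_split hφx fun l hl => hnil l (by rintro rfl; exact hB.1 hl)
    (by rintro rfl; exact hB.2 hl)] at key
  have hV := (key.1 ⟨?_, by simp only [List.count_append] at hcount ⊢; omega⟩).1
  · rw [List.append_nil, run_append, hL] at hV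
    simp [start, step] at hV
  · rw [List.append_nil, run_append, hL]
    refine run_l0 (flatMap_le_one fun l _ => ?_) (List.mem_flatMap.2 ⟨x, hx, by simp [hφx]⟩)
    simp only [hφ]
    split_ifs <;> simp

/-! ### Long alternation: first occurrences commute -/

/-- `P` contains a scattered alternating word in `z`, `z'` of length `k` whose last letter is `z`. -/
def HasAlt : ℕ → ℕ → ℕ → List ℕ → Prop
  | 0, _, _, _ => True
  | k + 1, z, z', P => ∃ P' Q, P = P' ++ z :: Q ∧ HasAlt k z' z P'

theorem HasAlt.append {k z z' : ℕ} {P : List ℕ} (h : HasAlt k z z' P) (R : List ℕ) :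
    HasAlt k z z' (P ++ R) := by
  cases k with
  | zero => trivial
  | succ k =>
    obtain ⟨P', Q, rfl, h⟩ := h
    exact ⟨P', Q ++ R, by simp, h⟩

theorem HasAlt.mono {j k z z' : ℕ} {P : List ℕ} (h : HasAlt k z z' P) (hjk : j ≤ k) :
    HasAlt j z z' P := by
  induction j generalizing k z z' P with
  | zero => trivial
  | succ j ih =>
    obtain ⟨k, rfl⟩ : ∃ i, k = i + 1 := ⟨k - 1, by omega⟩
    obtain ⟨P', Q, rfl, h⟩ := h
    exact ⟨P', Q, rfl, ih h (by omega)⟩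

theorem Runs.hasAlt {K : ℕ → Prop} {d z z' : ℕ} {P : List ℕ} (h : Runs K d z z' P) :
    HasAlt d z z' P := by
  induction h with
  | base z z' P h1 h2 =>
    obtain ⟨A, B, rfl⟩ := List.append_of_mem h1
    exact ⟨A, B, rfl, trivial⟩
  | step d z z' P s Q h1 hs hzQ hz'Q ih =>
    obtain ⟨A, B, rfl⟩ := List.append_of_mem hz'Q
    exact ⟨P ++ s :: A, B, by simp, ih.append _⟩

/-- The alternating word of length `k` in `z`, `z'` with last letter `z`. -/
def alt : ℕ → ℕ → ℕ → List ℕ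
  | 0, _, _ => []
  | k + 1, z, z' => alt k z' z ++ [z]

theorem hasAlt_alt (k z z' : ℕ) (P : List ℕ) : HasAlt k z z' (P ++ alt k z z') := by
  induction k generalizing z z' with
  | zero => trivial
  | succ k ih => exact ⟨P ++ alt k z' z, [], by simp [alt], ih z' z⟩

theorem mem_alt {k z z' c : ℕ} (h : c ∈ alt k z z') : c = z ∨ c = z' := by
  induction k generalizing z z' with
  | zero => simp [alt] at h
  | succ k ih =>
    rcases List.mem_append.1 h with h | h
    · exact (ih h).symm
    · left; simpa using h

theorem lt_of_mem_hd {e l : ℕ} (h : l ∈ hd e) : l < e + 3 := by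
  induction e with
  | zero => simp [hd] at h
  | succ e ih =>
    simp only [hd, List.mem_cons] at h
    have := cl_le e
    rcases h with h | h | h
    · omega
    · omega
    · have := ih h; omega

section

variable {N : Type u} [Monoid N] (g : ℕ → N)

/-- The alternating subword plays the letters `a`, `b` in the prefix of `uWord m`, and the gaps
between its letters are the values of the t-letters. Each induction step assigns the gap after its
last letter to `e + 3`. -/
theorem IsE1Sigma.ev_hasAlt {m : ℕ} (hN : IsE1Sigma m N) {j z z' : ℕ} {P : List ℕ}
    (h : HasAlt j z z' P) {e : ℕ} (he : e + j = m) {θ : ℕ → N} (hz : θ (cl e) = g z)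
    (hz' : θ (cl (e + 1)) = g z') :
    ev g P * ev θ (hd e ++ [0, 0, 1, 1]) = ev g P * ev θ (hd e ++ [1, 1, 0, 0]) := by
  induction j generalizing z z' P e θ with
  | zero =>
    obtain rfl : e = m := by omega
    rw [hN.sigma θ]
  | succ j ih =>
    obtain ⟨P', Q, rfl, h⟩ := h
    have hup : ∀ l, l < e + 3 → Function.update θ (e + 3) (ev g Q) l = θ l := fun l hl =>
      Function.update_of_ne (by omega) _ _
    have hcl := cl_le e
    have hcl' := cl_le (e + 1)
    have key := ih h (e := e + 1) (θ := Function.update θ (e + 3) (ev g Q)) (by omega)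
      (by rw [hup _ (by omega), hz']) (by rw [cl_add_two, hup _ (by omega), hz])
    have hev : ∀ w : List ℕ, (∀ l ∈ w, l < e + 3) →
        ev (Function.update θ (e + 3) (ev g Q)) w = ev θ w := fun w hw =>
      ev_congr fun l hl => hup l (hw l hl)
    have h1 : ∀ l ∈ hd e ++ [0, 0, 1, 1], l < e + 3 := fun l hl => by
      rcases List.mem_append.1 hl with hl | hl
      · exact lt_of_mem_hd hl
      · simp at hl; omega
    have h2 : ∀ l ∈ hd e ++ [1, 1, 0, 0], l < e + 3 := fun l hl => by
      rcases List.mem_append.1 hl with hl | hl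
      · exact lt_of_mem_hd hl
      · simp at hl; omega
    rw [hd, List.cons_append, List.cons_append, List.cons_append, List.cons_append, ev_cons, ev_cons,
      ev_cons, ev_cons, hev _ h1, hev _ h2, Function.update_self, hup _ (by omega), hz] at key
    simpa only [ev_append, ev_cons, mul_assoc] using key

theorem IsE1Sigma.hasAlt_swap {m : ℕ} (hN : IsE1Sigma m N) {z z' : ℕ} {P : List ℕ}
    (h : HasAlt m z z' P) (S : List ℕ) :
    ev g (P ++ [z, z, z', z'] ++ S) = ev g (P ++ [z', z', z, z] ++ S) := by
  have := hN.ev_hasAlt g h (e := 0) (by omega) (θ := fun i => if i = 0 then g z else g z')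
    (by simp) (by simp [cl])
  rw [ev_append, ev_append _ _ S, ev_append, ev_append]
  exact congrArg (· * ev g S) this

theorem IsE1.ev_inBlock (hN : IsE1 N) {K : ℕ → Prop} {x : ℕ} {p B : List ℕ} (h : InBlock K x p)
    (hx : K x) (hK : ∀ l, K l → 2 ≤ (p ++ B).count l) : ev g (p ++ x :: B) = ev g (p ++ B) := by
  obtain ⟨p₁, p₂, rfl, hp⟩ := h
  have := hN.ev_absorb g (A := p₁) (D := x :: p₂) (C := [x]) (B := B) (by simp)
    fun d hd => by
      refine hK d ?_
      rcases List.mem_cons.1 hd with rfl | hd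
      exacts [hx, hp d hd]
  simpa using this

/-- A sufficient condition for two adjacent first occurrences `x`, `y` after `p` to commute. -/
def Swappable (K : ℕ → Prop) (m x y : ℕ) (p : List ℕ) : Prop :=
  InBlock K y p ∨ Both K x y p ∨ HasAlt m x y p ∨ HasAlt m y x p

/-- If `y` is already in the block, y² can be inserted and erased freely. If some block contains
both letters, an alternating word of length `m` can be inserted there at no cost, and σₘ applies as
in the remaining cases. -/
theorem IsE1Sigma.swap {m : ℕ} (hN : IsE1Sigma m N) {K : ℕ → Prop} {x y : ℕ} {p w S : List ℕ}
    (h : Swappable K m x y p) (hx : K x) (hy : K y) (hw : ∀ l ∈ w, K l)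
    (hK : ∀ l, K l → 2 ≤ (p ++ w ++ y :: x :: S).count l) :
    ev g (p ++ w ++ [y, y, x, x] ++ S) = ev g (p ++ w ++ [x, x, y, y] ++ S) := by
  rcases h with ⟨p₁, p₂, rfl, hp⟩ | ⟨P₁, z, M, z', Q, rfl, hz, hM⟩ | h | h
  · have hD : ∀ l ∈ y :: p₂ ++ w, K l := fun l hl => by
      simp only [List.cons_append, List.mem_cons, List.mem_append] at hl
      rcases hl with rfl | hl | hl
      exacts [hy, hp l hl, hw l hl]
    have e1 := hN.toIsE1.ev_absorb g (A := p₁) (D := y :: p₂ ++ w ++ [y, y, x, x]) (C := [y, y])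
      (B := S) (by simp) fun d hd => by
        have : K d := by
          rcases List.mem_append.1 hd with hd | hd
          · exact hD d hd
          · simp at hd; rcases hd with rfl | rfl <;> assumption
        have := hK d this
        simp only [List.count_append, List.count_cons, List.count_nil] at this ⊢
        omega
    have e2 := hN.toIsE1.ev_absorb g (A := p₁) (D := y :: p₂ ++ w) (C := [y, y])
      (B := [x, x, y, y] ++ S) (by simp) fun d hd => by
        have := hK d (hD d hd)
        simp only [List.count_append, List.count_cons, List.count_nil] at this ⊢
        omega
    simp only [List.append_assoc, List.cons_append, List.nil_append] at e1 e2 ⊢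
    rw [← e1, e2]
  · have hzz : K z ∧ K z' := by rcases hz with ⟨rfl, rfl⟩ | ⟨rfl, rfl⟩ <;> exact ⟨by assumption, by assumption⟩
    have hab : ∀ B : List ℕ, (∀ l, (y :: x :: S).count l ≤ B.count l) →
        ev g (P₁ ++ (z :: M ++ [z']) ++ alt m y x ++ (Q ++ w ++ B))
          = ev g (P₁ ++ (z :: M ++ [z']) ++ (Q ++ w ++ B)) := fun B hB => by
      refine hN.toIsE1.ev_absorb g (fun c hc => ?_) fun d hd => ?_
      · rcases hz with ⟨rfl, rfl⟩ | ⟨rfl, rfl⟩ <;> rcases mem_alt hc with rfl | rfl <;> simp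
      · have hd' : K d := by
          simp only [List.cons_append, List.mem_cons, List.mem_append, List.not_mem_nil,
            or_false] at hd
          rcases hd with rfl | hd | rfl
          exacts [hzz.1, hM d hd, hzz.2]
        have h1 := hK d hd'
        have h2 := hB d
        simp only [List.count_append, List.count_cons, List.count_nil] at h1 h2 ⊢
        omega
    have e1 := hab ([y, y, x, x] ++ S) fun l => by
      simp only [List.count_append, List.count_cons, List.count_nil]; omega
    have e2 := hab ([x, x, y, y] ++ S) fun l => by
      simp only [List.count_append, List.count_cons, List.count_nil]; omega
    have e3 := hN.hasAlt_swap g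
      ((hasAlt_alt m y x (P₁ ++ (z :: M ++ [z']))).append (Q ++ w)) S
    simp only [List.append_assoc, List.cons_append, List.nil_append] at e1 e2 e3 ⊢
    rw [← e1, ← e2, e3]
  · exact (hN.hasAlt_swap g (h.append w) S).symm
  · exact hN.hasAlt_swap g (h.append w) S

/-- A copy of `x` walks left through `w`: squares are created, exchanged by `IsE1Sigma.swap` and
reduced again, and surplus copies of `x` left on the way are absorbed. -/
theorem IsE1Sigma.move {m : ℕ} (hN : IsE1Sigma m N) {K : ℕ → Prop} {x : ℕ} {p w S : List ℕ}
    (hx : K x) (hw : ∀ y ∈ w, K y ∧ Swappable K m x y p)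
    (hK : ∀ l, K l → 2 ≤ (p ++ w ++ x :: S).count l) :
    ev g (p ++ w ++ x :: S) = ev g (p ++ x :: w ++ x :: S) := by
  induction w using List.reverseRecOn generalizing S with
  | nil =>
    have := hK x hx
    have h1 : x ∈ p ∨ x ∈ S := by
      by_contra hc
      rw [not_or] at hc
      simp [List.count_eq_zero_of_not_mem hc.1, List.count_eq_zero_of_not_mem hc.2] at this
    simpa using (hN.toIsE1.ev_sq g h1).symm
  | append_singleton w y ih =>
    have hy := hw y (by simp)
    have hwK : ∀ l ∈ w, K l := fun l hl => (hw l (by simp [hl])).1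
    have hK' : ∀ l, K l → 2 ≤ (p ++ w ++ y :: x :: S).count l := fun l hl => by
      simpa using hK l hl
    have cont : ∀ (z : ℕ) (A B : List ℕ), 2 ≤ (A ++ z :: B).count z →
        ev g (A ++ z :: z :: B) = ev g (A ++ z :: B) := fun z A B hz => by
      refine hN.toIsE1.ev_sq g ?_
      by_contra hc
      rw [not_or] at hc
      simp [List.count_eq_zero_of_not_mem hc.1, List.count_eq_zero_of_not_mem hc.2] at hz
    have e1 := cont y (p ++ w) (x :: S) (hK' y hy.1)
    have e2 := cont x (p ++ w ++ [y, y]) S (by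
      have := hK' x hx
      simp only [List.count_append, List.count_cons, List.count_nil] at this ⊢
      omega)
    have e3 := hN.swap g hy.2 hx hy.1 hwK hK'
    have e4 := hN.toIsE1.ev_absorb g (A := p ++ w) (D := [x, x, y, y]) (C := [x]) (B := S) (by simp)
      fun d hd => by
        have h1 : K d := by
          simp at hd; rcases hd with rfl | rfl
          exacts [hx, hy.1]
        have := hK' d h1
        simp only [List.count_append, List.count_cons, List.count_nil] at this ⊢
        omega
    have e5 := cont x (p ++ w) (y :: y :: x :: S) (by
      have := hK' x hx
      simp only [List.count_append, List.count_cons] at this ⊢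
      omega)
    have e6 := cont y (p ++ w ++ [x]) (x :: S) (by
      have := hK' y hy.1
      simp only [List.count_append, List.count_cons, List.count_nil] at this ⊢
      omega)
    have e7 := ih (S := y :: x :: S) (fun l hl => hw l (by simp [hl])) fun l hl => by
      have := hK' l hl
      simp only [List.count_append, List.count_cons] at this ⊢
      omega
    have e8 := hN.toIsE1.ev_absorb g (A := p) (D := x :: w) (C := [x]) (B := y :: x :: S) (by simp)
      fun d hd => by
        have h1 : K d := by
          rcases List.mem_cons.1 hd with rfl | hd
          exacts [hx, hwK d hd]
        have := hK' d h1
        simp only [List.count_append, List.count_cons] at this ⊢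
        omega
    simp only [List.append_assoc, List.cons_append, List.nil_append] at e1 e2 e3 e4 e5 e6 e7 e8 ⊢
    rw [← e1, ← e2, e3, ← e4, e5, e6, e7, e8]

end

section

variable {n : ℕ} (hn : 1 ≤ n) {p u v : List ℕ} {x : ℕ} (h : Rho n (p ++ u) (p ++ x :: v))
  {K : ℕ → Prop} (hK : ∀ l, K l ↔ 2 ≤ (p ++ u).count l)
include hn h hK

/-- After `p`, `y` comes before `x` in one word and `x` comes first in the other. If no condition
for swapping holds, `p` has at most n runs of `x`, `y` (n + 1 of them would yield the alternation),
so the difference in order would be detected. -/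
theorem Rho.swappable (hx : K x) (hxp : ¬ InBlock K x p) {w u' : List ℕ} (hu : u = w ++ x :: u')
    (hxw : x ∉ w) {y : ℕ} (hy : y ∈ w) (hyK : K y) : Swappable K (n + 1) x y p := by
  by_contra hcon
  simp only [Swappable, not_or] at hcon
  obtain ⟨hyp, hboth, ha1, ha2⟩ := hcon
  have hxy : x ≠ y := by rintro rfl; exact hxw hy
  obtain ⟨w₁, w₂, rfl, hyw₁⟩ := List.eq_append_cons_of_mem hy
  have hxw₁ : x ∉ w₁ := fun h' => hxw (by simp [h'])
  have hyV := h.symm.two_le_count hn ((hK y).1 hyK)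
  subst hu
  rcases runs_trichotomy hxy hx hyK p with ⟨hx0, hy0⟩ | hb | ⟨d, z, z', hz, -, hP⟩
  · refine Rho.fresh_false (n := n) (A₁ := p ++ w₁) (A₂ := w₂ ++ x :: u') (B₁ := p) (B₂ := v) hxy
      (by simpa using h) (by simp [hx0, hxw₁, hyw₁, hy0]) ⟨hx0, hy0⟩ (by simp) ?_
    simpa using (hK y).1 hyK
  · exact hboth hb
  · rcases hP with hP | ⟨P₀, s, Q, rfl, hs, hR, hQx, hQy⟩
    · rcases hz with ⟨rfl, rfl⟩ | ⟨rfl, rfl⟩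
      exacts [hxp hP, hyp hP]
    · have hd : d ≤ n := by
        by_contra hd
        have hA := ((hR.hasAlt).mono (j := n + 1) (by omega)).append (s :: Q)
        rcases hz with ⟨rfl, rfl⟩ | ⟨rfl, rfl⟩
        exacts [ha1 hA, ha2 hA]
      rcases hz with ⟨rfl, rfl⟩ | ⟨rfl, rfl⟩
      · exact Rho.runs_false hn (A₁ := w₁) (A₂ := w₂ ++ z :: u') (B₁ := []) (B₂ := v)
          (by simpa using h) (by simpa using hK) hs hR hd hx hyK hxy ⟨hQx, hQy⟩ ⟨hxw₁, hyw₁⟩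
          (by simp) (by simp)
      -- Here the last run consists of the letter `y`, so the word starting with `x` must be the
      -- accepted one; it needs a later `y` to supply the `a` after the `b`.
      · have hyv : z ∈ Q ++ z' :: v := h.symm.mem_right hn (s := s) (U₁ := P₀) (V₁ := P₀)
          (V₂ := Q ++ (w₁ ++ z :: w₂ ++ z' :: u')) (by simp) (by simp)
          ((h.count hn).2 (count_eq_one_of hK hs (by simp))) hyV (by simp)
        have hyv' : z ∈ v := by simpa [hQy, hxy.symm] using hyv
        have hKV : ∀ l, K l ↔ 2 ≤ (P₀ ++ s :: Q ++ ([] ++ z' :: v)).count l := fun l => by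
          rw [hK]
          exact ⟨fun h' => h.symm.two_le_count hn h', fun h' => h.two_le_count hn h'⟩
        exact Rho.runs_false hn (A₁ := []) (A₂ := v) (B₁ := w₁) (B₂ := w₂ ++ z' :: u')
          (by simpa using h.symm) hKV hs hR hd hyK hx hxy.symm ⟨hQy, hQx⟩ (by simp)
          ⟨hyw₁, hxw₁⟩ hyv'

/-- If the next letter on one side is multiple, it may be inserted on the other side. -/
theorem Rho.ev_insert {N : Type u} [Monoid N] (hN : IsE1Sigma (n + 1) N) (g : ℕ → N) (hx : K x) :
    ev g (p ++ u) = ev g (p ++ x :: u) := by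
  by_cases hxp : InBlock K x p
  · exact (hN.toIsE1.ev_inBlock g hxp hx fun l hl => (hK l).1 hl).symm
  · rcases h.inBlock_or hn hK hx with h' | ⟨w, u', rfl, hw, hxw⟩
    · exact absurd h' hxp
    · have := hN.move g (p := p) (w := w) (S := u') hx
        (fun y hy => ⟨hw y hy, h.swappable hn hK hx hxp rfl hxw hy (hw y hy)⟩)
        (fun l hl => by simpa using (hK l).1 hl)
      simpa using this

/-- If the next letter on one side is simple, it may be moved up on the other side. -/
theorem Rho.ev_simple {N : Type u} [Monoid N] (hN : IsE1 N) (g : ℕ → N) (hx : ¬ K x)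
    {w u' : List ℕ} (hu : u = w ++ x :: u') (hw : ∀ y ∈ w, K y ∧ InBlock K y p) :
    ev g (p ++ u) = ev g (p ++ x :: u') := by
  subst hu
  have hx1 : (p ++ (w ++ x :: u')).count x = 1 := count_eq_one_of hK hx (by simp)
  have hxV := (h.count hn).2 hx1
  -- Deleting `w` keeps multiple letters multiple: a letter of `w` occurs in `p`, and either it
  -- occurs there twice or it occurs in `v`, hence also in `u'`.
  have hcount : ∀ l, K l → 2 ≤ (p ++ x :: u').count l := by
    intro l hl
    have h1 := (hK l).1 hl
    have hxl : x ≠ l := by rintro rfl; exact hx hl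
    by_cases hlw : l ∈ w
    · have h2 := h.symm.two_le_count hn h1
      obtain ⟨p₁, p₂, hp, -⟩ := (hw l hlw).2
      have h3 : 1 ≤ p.count l := List.count_pos_iff.2 (by simp [hp])
      have h5 : l ∈ v → 1 ≤ u'.count l := fun hlv =>
        List.count_pos_iff.2 (h.mem_right hn (s := x) (U₁ := p ++ w) (V₁ := p) (V₂ := v) (by simp)
          rfl hx1 h1 hlv)
      rw [List.count_append, List.count_cons_of_ne hxl] at h2 ⊢
      by_cases hlv : l ∈ v
      · have := h5 hlv; omega
      · rw [List.count_eq_zero_of_not_mem hlv] at h2; omega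
    · rw [List.count_append, List.count_append, List.count_eq_zero_of_not_mem hlw] at h1
      rw [List.count_append]
      omega
  clear h hK hx1 hxV
  induction w with
  | nil => rfl
  | cons y w ih =>
    rw [← ih fun z hz => hw z (by simp [hz])]
    have hy := hw y (by simp)
    exact hN.ev_inBlock g (B := w ++ x :: u') hy.2 hy.1 fun l hl => by
      have := hcount l hl
      simp only [List.count_append] at this ⊢
      omega

end

/-! ### Greedy rewriting of one side of an identity into the other -/

theorem ev_mk (c : Con Word) (w : List ℕ) :
    ev (fun i => ((FreeMonoid.of i : Word) : c.Quotient)) w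
      = ((FreeMonoid.ofList w : Word) : c.Quotient) := by
  rw [← lift_mk_eq, lift_eq_ev]; rfl

theorem exists_rep (c : Con Word) (θ : ℕ → c.Quotient) :
    ∃ φ : ℕ → List ℕ, θ = fun i => ev (fun i => ((FreeMonoid.of i : Word) : c.Quotient)) (φ i) := by
  choose φ hφ using fun i => Con.mk'_surjective (c := c) (θ i)
  refine ⟨fun i => (φ i).toList, funext fun i => ?_⟩
  rw [ev_mk, ← hφ]; rfl

theorem synCon_iff_of_eq {n : ℕ} {X Y : List ℕ}
    (h : ev (fun i => ((FreeMonoid.of i : Word) : (synCon n).Quotient)) X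
      = ev (fun i => ((FreeMonoid.of i : Word) : (synCon n).Quotient)) Y) (P S : List ℕ) :
    InV n (P ++ X ++ S) ↔ InV n (P ++ Y ++ S) := by
  rw [ev_mk, ev_mk, Con.eq] at h
  exact h (FreeMonoid.ofList P) (FreeMonoid.ofList S)

theorem flatMap_uWord (φ : ℕ → List ℕ) (n : ℕ) : (hd n ++ [0, 0, 1, 1]).flatMap φ
    = (hd n).flatMap φ ++ (φ 0 ++ φ 0 ++ φ 1 ++ φ 1) := by simp

theorem flatMap_vWord (φ : ℕ → List ℕ) (n : ℕ) : (hd n ++ [1, 1, 0, 0]).flatMap φ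
    = (hd n).flatMap φ ++ (φ 1 ++ φ 1 ++ φ 0 ++ φ 0) := by simp

theorem isE1Sigma_synCon (n : ℕ) : IsE1Sigma (n + 1) (synCon n).Quotient := by
  refine ⟨isE1_synCon n, fun θ => ?_⟩
  obtain ⟨φ, rfl⟩ := exists_rep _ θ
  rw [← ev_flatMap, ← ev_flatMap, flatMap_uWord, flatMap_vWord]
  have key := fun R hR P S =>
    (isE1_synCon n).ev_sigma (fun i => ((FreeMonoid.of i : Word) : (synCon n).Quotient)) (φ := φ)
      (n := n) (P := P) (R := R) (S := S) hR
  rw [ev_mk, ev_mk, Con.eq]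
  intro P S
  constructor
  · intro h
    exact (synCon_iff_of_eq (key _ (Or.inl rfl) P.toList S.toList h) P.toList S.toList).1 h
  · intro h
    exact (synCon_iff_of_eq (key _ (Or.inr rfl) P.toList S.toList h) P.toList S.toList).2 h

/-- Identities of `𝔼¹{σ_{n+1}}` hold in the syntactic monoid of the `β`-class of `vWord n`. -/
theorem rho_of_ev {n : ℕ} {U V : List ℕ} (h : ∀ g : ℕ → (synCon n).Quotient, ev g U = ev g V) :
    Rho n U V := by
  intro φ P S
  apply synCon_iff_of_eq
  rw [ev_flatMap, ev_flatMap, h]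

theorem Rho.trans {n : ℕ} {U V W : List ℕ} (h : Rho n U V) (h' : Rho n V W) : Rho n U W :=
  fun φ P S => (h φ P S).trans (h' φ P S)

/-- Once one side is used up, the remaining letters of the other cannot be simple, so they are
inserted one by one. -/
theorem Rho.ev_eq_append {n : ℕ} (hn : 1 ≤ n) {N : Type u} [Monoid N] (hN : IsE1Sigma (n + 1) N)
    (g : ℕ → N) {p v : List ℕ} (h : Rho n (p ++ []) (p ++ v)) :
    ev g (p ++ []) = ev g (p ++ v) := by
  induction v generalizing p with
  | nil => rfl
  | cons x v ih =>
    by_cases hx : 2 ≤ (p ++ []).count x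
    · have h1 := rho_of_ev fun g' => h.ev_insert hn (fun _ => Iff.rfl) (isE1Sigma_synCon n) g' hx
      rw [h.ev_insert hn (fun _ => Iff.rfl) hN g hx]
      have h2 := ih (p := p ++ [x]) (by simpa using h1.symm.trans h)
      simpa using h2
    · obtain ⟨w, u', h', -⟩ := h.simple_split hn (fun _ => Iff.rfl) hx
      simp at h'

/-- Identities of the syntactic monoid of the `β`-class of `vWord n` hold in `𝔼¹{σ_{n+1}}`. -/
theorem Rho.ev_eq_of_append {n : ℕ} (hn : 1 ≤ n) {N : Type u} [Monoid N]
    (hN : IsE1Sigma (n + 1) N) (g : ℕ → N) {p u v : List ℕ} (h : Rho n (p ++ u) (p ++ v)) :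
    ev g (p ++ u) = ev g (p ++ v) := by
  induction v generalizing p u with
  | nil => exact (h.symm.ev_eq_append hn hN g).symm
  | cons x v ih =>
    by_cases hx : 2 ≤ (p ++ u).count x
    -- The rewriting is valid in the syntactic monoid as well, so the new word is still
    -- `Rho`-related to the target and the induction continues with the longer common prefix.
    · have h1 := rho_of_ev fun g' => h.ev_insert hn (fun _ => Iff.rfl) (isE1Sigma_synCon n) g' hx
      rw [h.ev_insert hn (fun _ => Iff.rfl) hN g hx]
      have h2 := ih (p := p ++ [x]) (u := u) (by simpa using h1.symm.trans h)
      simpa using h2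
    · obtain ⟨w, u', hu, hw⟩ := h.simple_split hn (fun _ => Iff.rfl) hx
      have h1 := rho_of_ev fun g' =>
        h.ev_simple hn (fun _ => Iff.rfl) (isE1_synCon n) g' hx hu hw
      rw [h.ev_simple hn (fun _ => Iff.rfl) hN.toIsE1 g hx hu hw]
      have h2 := ih (p := p ++ [x]) (u := u') (by simpa using h1.symm.trans h)
      simpa using h2

theorem Rho.ev_eq {n : ℕ} (hn : 1 ≤ n) {N : Type u} [Monoid N] (hN : IsE1Sigma (n + 1) N)
    (g : ℕ → N) {u v : List ℕ} (h : Rho n u v) : ev g u = ev g v :=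
  Rho.ev_eq_of_append hn hN g (p := []) h

/-! ### The Rees quotient, generation and stability -/

theorem satisfies_uLift_iff {M : Type} [Monoid M] {p q : Word} :
    Satisfies (ULift.{u} M) p q ↔ Satisfies M p q := by
  have key : ∀ (f : ℕ → ULift.{u} M) (w : Word),
      (FreeMonoid.lift f w).down = FreeMonoid.lift (fun i => (f i).down) w := fun f w => by
    rw [lift_eq_ev, lift_eq_ev]
    generalize w.toList = l
    induction l with
    | nil => rfl
    | cons x l ih => rw [ev_cons, ev_cons, ← ih]; rfl
  constructor
  · intro h f
    have := congrArg ULift.down (h fun i => ULift.up (f i))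
    rwa [key, key] at this
  · intro h f
    apply ULift.ext
    rw [key, key]
    exact h _

/-- The canonical map from words to `M_β([vWord n])`. -/
def toMW (n : ℕ) (w : List ℕ) : MW beta (betaClass (vWord n)) :=
  (((FreeMonoid.ofList w : Word) : beta.Quotient) : (MWCon beta (betaClass (vWord n))).Quotient)

theorem ev_toMW (n : ℕ) (φ : ℕ → List ℕ) (w : List ℕ) :
    ev (fun i => toMW n (φ i)) w = toMW n (w.flatMap φ) := by
  induction w with
  | nil => rfl
  | cons l w ih => rw [ev_cons, ih, List.flatMap_cons]; rfl

theorem exists_toMW {n : ℕ} (f : ℕ → MW beta (betaClass (vWord n))) :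
    ∃ φ : ℕ → List ℕ, f = fun i => toMW n (φ i) := by
  have : ∀ m : MW beta (betaClass (vWord n)), ∃ w, toMW n w = m := by
    intro m
    induction m using Con.induction_on with | _ c
    induction c using Con.induction_on with | _ w
    exact ⟨w.toList, rfl⟩
  choose φ hφ using fun i => this (f i)
  exact ⟨φ, funext fun i => (hφ i).symm⟩

theorem beta_iff {X Y : List ℕ} : beta (FreeMonoid.ofList X) (FreeMonoid.ofList Y) ↔
    ∀ (N : Type) [Monoid N], IsE1 N → ∀ g : ℕ → N, ev g X = ev g Y := by
  constructor
  · intro h N _ hN g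
    have := h N (mem_E1_iff.2 hN) g
    rwa [lift_eq_ev, lift_eq_ev] at this
  · intro h N _ hN g
    rw [lift_eq_ev, lift_eq_ev]
    exact h N (mem_E1_iff.1 hN) g

theorem not_outside_iff {n : ℕ} (hn : 1 ≤ n) {X : List ℕ} :
    ((FreeMonoid.ofList X : Word) : beta.Quotient) ∉ outside beta (betaClass (vWord n)) ↔
      ∃ P S, InV n (P ++ X ++ S) := by
  simp only [outside, Set.mem_ofPred_eq, not_not]
  constructor
  · rintro ⟨w, hw, p, s, h⟩
    induction p using Con.induction_on with | _ p
    induction s using Con.induction_on with | _ s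
    rw [← Con.coe_mul, ← Con.coe_mul, Con.eq] at h
    exact ⟨p.toList, s.toList, (mem_betaClass_iff hn _).1 (beta.trans hw h)⟩
  · rintro ⟨P, S, h⟩
    refine ⟨FreeMonoid.ofList (P ++ X ++ S), (mem_betaClass_iff hn _).2 h,
      ((FreeMonoid.ofList P : Word) : beta.Quotient), ((FreeMonoid.ofList S : Word) : beta.Quotient),
      rfl⟩

theorem toMW_eq_iff {n : ℕ} {X Y : List ℕ} : toMW n X = toMW n Y ↔
    beta (FreeMonoid.ofList X) (FreeMonoid.ofList Y) ∨
      ((FreeMonoid.ofList X : Word) : beta.Quotient) ∈ outside beta (betaClass (vWord n)) ∧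
      ((FreeMonoid.ofList Y : Word) : beta.Quotient) ∈ outside beta (betaClass (vWord n)) := by
  unfold toMW
  rw [Con.eq, ← Con.eq (c := beta)]
  rfl

theorem isE1Sigma_MW {n : ℕ} (hn : 1 ≤ n) :
    IsE1Sigma (n + 1) (MW beta (betaClass (vWord n))) := by
  have hβ : ∀ {X Y : List ℕ} (φ : ℕ → List ℕ),
      (∀ (N : Type) [Monoid N], IsE1 N → ∀ g : ℕ → N, ev g X = ev g Y) →
      ev (fun i => toMW n (φ i)) X = ev (fun i => toMW n (φ i)) Y := fun φ H => by
    rw [ev_toMW, ev_toMW, toMW_eq_iff]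
    exact Or.inl (beta_iff.2 fun N _ hN g => by rw [ev_flatMap, ev_flatMap, H N hN])
  refine ⟨mem_E1_iff.1 ?_, ?_⟩
  · intro p hp f
    obtain ⟨φ, rfl⟩ := exists_toMW f
    rw [lift_eq_ev, lift_eq_ev]
    refine hβ φ fun N _ hN g => ?_
    have := mem_E1_iff.2 hN p hp g
    rwa [lift_eq_ev, lift_eq_ev] at this
  · intro f
    obtain ⟨φ, rfl⟩ := exists_toMW f
    rw [ev_toMW, ev_toMW, toMW_eq_iff, flatMap_uWord, flatMap_vWord]
    by_contra hcon
    rw [not_or, not_and_or, not_outside_iff hn, not_outside_iff hn] at hcon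
    obtain ⟨h1, h2⟩ := hcon
    apply h1
    rw [beta_iff]
    intro N _ hN g
    rcases h2 with ⟨P, S, h⟩ | ⟨P, S, h⟩
    · exact hN.ev_sigma g (Or.inl rfl) h
    · exact hN.ev_sigma g (Or.inr rfl) h

/-- An instance that divides an accepted word is not collapsed in the Rees quotient, so there
equality means β, and the β-class is closed under β. -/
theorem rho_of_satisfies_MW {n : ℕ} (hn : 1 ≤ n) {p q : Word}
    (h : Satisfies (MW beta (betaClass (vWord n))) p q) : Rho n p.toList q.toList := by
  have key : ∀ {p q : Word}, Satisfies (MW beta (betaClass (vWord n))) p q →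
      ∀ (φ : ℕ → List ℕ) (P S : List ℕ), InV n (P ++ p.toList.flatMap φ ++ S) →
        InV n (P ++ q.toList.flatMap φ ++ S) := by
    intro p q h φ P S hV
    have h1 := h fun i => toMW n (φ i)
    rw [lift_eq_ev, lift_eq_ev, ev_toMW, ev_toMW, toMW_eq_iff] at h1
    rcases h1 with h1 | ⟨h1, -⟩
    · have h2 := (mem_betaClass_iff hn (FreeMonoid.ofList (P ++ p.toList.flatMap φ ++ S))).2 hV
      exact (mem_betaClass_iff hn (FreeMonoid.ofList (P ++ q.toList.flatMap φ ++ S))).1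
        (beta.trans h2 (beta.mul (beta.mul (beta.refl (FreeMonoid.ofList P)) h1)
          (beta.refl (FreeMonoid.ofList S))))
    · exact absurd h1 ((not_outside_iff hn).2 ⟨P, S, hV⟩)
  exact fun φ P S => ⟨key h φ P S, key (fun f => (h f).symm) φ P S⟩

theorem Rho.satisfies {n : ℕ} (hn : 1 ≤ n) {N : Type u} [Monoid N]
    (hN : (E1sigma.{u} (n + 1)).Mem N) {p q : Word} (h : Rho n p.toList q.toList) :
    Satisfies N p q := fun g => by
  rw [lift_eq_ev, lift_eq_ev]
  exact h.ev_eq hn (mem_E1sigma_iff.1 hN) g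

theorem mem_E1sigma_uLift {n : ℕ} (hn : 1 ≤ n) :
    (E1sigma.{u} (n + 1)).Mem (ULift.{u} (MW beta (betaClass (vWord n)))) :=
  fun p hp => satisfies_uLift_iff.2 (mem_E1sigma_iff.2 (isE1Sigma_MW hn) p hp)

theorem E1sigma_eq_varMW {n : ℕ} (hn : 1 ≤ n) :
    E1sigma.{u} (n + 1) = varMW.{u} beta (betaClass (vWord n)) := by
  ext N _
  constructor
  · intro hN V hV
    obtain ⟨S, hS⟩ := V.equational
    refine (hS N).2 fun p hp => ?_
    exact (rho_of_satisfies_MW hn (satisfies_uLift_iff.1 ((hS _).1 hV p hp))).satisfies hn hN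
  · intro h
    exact h _ (mem_E1sigma_uLift hn)

theorem Rho.mem_iff {n : ℕ} {u v : List ℕ} (h : Rho n u v) : InV n u ↔ InV n v := by
  have h1 := h (fun l => [l]) [] []
  simpa using h1

/-- If `V` contains 𝔼¹{σₙ₊₁}, it contains the Rees quotient, whose identities preserve the class.
Conversely the identities of `V` are closed under substitutions and contexts, so stability of the
class makes each of them a `Rho` relation. -/
theorem E1sigma_le_iff_stable {n : ℕ} (hn : 1 ≤ n) (V : MonoidVariety.{u}) :
    E1sigma.{u} (n + 1) ≤ V ↔ V.Stable (betaClass (vWord n)) := by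
  constructor
  · intro h p hp q hpq
    have h1 := rho_of_satisfies_MW hn
      (satisfies_uLift_iff.1 (hpq _ (h _ (mem_E1sigma_uLift hn))))
    rw [mem_betaClass_iff hn] at hp ⊢
    exact h1.mem_iff.1 hp
  · intro h N _ hN
    obtain ⟨S, hS⟩ := V.equational
    have key : ∀ p q : Word, V.Models p q → ∀ (φ : ℕ → List ℕ) (P S : List ℕ),
        InV n (P ++ p.toList.flatMap φ ++ S) → InV n (P ++ q.toList.flatMap φ ++ S) := by
      intro p q hpq φ P S hV
      have h1 := h (FreeMonoid.ofList (P ++ p.toList.flatMap φ ++ S))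
        ((mem_betaClass_iff hn _).2 hV) (FreeMonoid.ofList (P ++ q.toList.flatMap φ ++ S)) (by
          intro M _ hM f
          have := hpq M hM fun i => ev f (φ i)
          rw [lift_eq_ev, lift_eq_ev, ← ev_flatMap, ← ev_flatMap] at this
          rw [lift_eq_ev, lift_eq_ev, FreeMonoid.toList_ofList, FreeMonoid.toList_ofList, ev_append,
            ev_append, ev_append, ev_append, this])
      exact (mem_betaClass_iff hn _).1 h1
    refine (hS N).2 fun p hp => ?_
    have hm : V.Models p.1 p.2 := fun M _ hM => (hS M).1 hM p hp
    have hm' : V.Models p.2 p.1 := fun M _ hM f => (hm M hM f).symm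
    exact Rho.satisfies hn hN fun φ P S => ⟨key _ _ hm φ P S, key _ _ hm' φ P S⟩

theorem betaClass_eq_of_mem {v w : Word} (h : w ∈ betaClass v) : betaClass w = betaClass v := by
  ext z
  exact ⟨fun hz => beta.trans h hz, fun hz => beta.trans (beta.symm h) hz⟩

end MonVar

theorem mainTheorem5 :
    (∀ n : ℕ, 1 ≤ n →
      MonVar.E1sigma.{u} (n + 1) = MonVar.varMW.{u} MonVar.beta (MonVar.betaClass (MonVar.vWord n))) ∧
    MonVar.E1sigma.{u} 2 =
      MonVar.varMW.{u} MonVar.beta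
        (MonVar.betaClass (MonVar.a * MonVar.t 1 * MonVar.b ^ 2 * MonVar.a)) ∧
    (∀ n : ℕ, 1 ≤ n → ∀ V : MonVar.MonoidVariety.{u},
      MonVar.E1sigma.{u} (n + 1) ≤ V ↔ V.Stable (MonVar.betaClass (MonVar.vWord n))) := by
  refine ⟨fun n hn => MonVar.E1sigma_eq_varMW hn, ?_, fun n hn V =>
    MonVar.E1sigma_le_iff_stable hn V⟩
  rw [MonVar.betaClass_eq_of_mem (v := MonVar.vWord 1)]
  · exact MonVar.E1sigma_eq_varMW le_rfl
  · rw [MonVar.mem_betaClass_iff le_rfl]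
    have h : (MonVar.a * MonVar.t 1 * MonVar.b ^ 2 * MonVar.a).toList = [0, 3, 1, 1, 0] := rfl
    rw [h]
    exact ⟨by simp [MonVar.start, MonVar.step], by simp⟩
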